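/- **Setting.** A *task graph* is a finite directed acyclic graph $G=(V,E)$ with terminals $s,t$, edge costs $c(e)\ge 0$, and every node on a path from $s$ to $t$. Let $d(w)$ be the cost of a cheapest path from $w$ to $t$. For $\beta\in(0,1]$ let $d_\beta(v,w)=c(v,w)+\beta d(w)$ for $(v,w)\in E$ and $d_\beta(v)=\min_{(v,w)\in E}d_\beta(v,w)$. A *present bias set* is a nonempty finite union $B\subset(0,1]$ of closed intervals (possibly single points); put $b=\min B$ and $\tau=\max B/\min B$. A *cost configuration* is a map $\tilde c:E\to\mathbb R_{\ge0}$; it changes the cost of every edge $e$ to $c(e)+\tilde c(e)$, and all quantities computed with these costs get the index $\tilde c$. For $\beta\in B^V$ and a reward $r\ge0$, an agent starting at $s$ quits at a node $v\ne t$ if $d_{\beta(v),\tilde c}(v)>\beta(v)r$, and otherwise moves along an arbitrary edge $(v,w)$ with $d_{\beta(v),\tilde c}(v,w)=d_{\beta(v),\tilde c}(v)$. The configuration $\tilde c$ is *motivating* for $\beta$ at reward $r$ if she never quits, however ties are broken. VPB-OPT asks, given $G$ and $B$, for $r(G,B^V)$, the infimum of all $r\ge 0$ for which some $\tilde c$ is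 motivating for all $\beta\in B^V$ at reward $r$. **Algorithm** (VariablePresentBiasApprox). Let $P$ be a path from $s$ to $t$ minimizing $\max_{e\in P}d_b(e)$, and let $\alpha$ be this minimum ($0$ if $s=t$). For every $v\ne t$ let $\varsigma(v)$ be the successor of $v$ on some cheapest path (for $c$) from $v$ to $t$, and let $T=\{(v,\varsigma(v))\mid v\neq t\}$. Set $\tilde c(e)=(1+\tau)\alpha/b+1$ for $e\in E\setminus(P\cup T)$. For $(v,w)\in T$ with $v\in P$, $w\notin P$, set $\tilde c(v,w)=\tau$ times the cost of a most expensive edge of the path $v,\varsigma(v),\varsigma(\varsigma(v)),\dots$ between $v$ and its first node other than $v$ that lies on $P$. Set $\tilde c(e)=0$ for all other edges. **Theorem.** VPB-OPT admits a polynomial-time $(1+\tau)$-approximation. More precisely: 1. For every task graph $G$ with real costs and every present bias set $B$, valid choices of $P$ and $\varsigma$ exist. For all such choices, the resulting $\tilde c$ is a cost configuration that is motivating for every $\beta\in B^V$ at reward $(1+\tau)\alpha/b$, and $$\frac{\alpha}{b}\;\le\; r(G,B^V)\;\le\;(1+\tau)\frac{\alpha}{b}.$$ 2. For rational costs and rational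 interval end points, there is an algorithm whose running time (on a random access machine on which every operation is charged the bit lengths of the numbers involved) is polynomial in the bit length of the input. It outputs the cost configuration $\tilde c$ of the algorithm above, for some valid $P$ and $\varsigma$, and the reward $\rho=(1+\tau)\alpha/b$. Consequently $\tilde c$ is motivating for all $\beta\in B^V$ at reward $\rho$, and $r(G,B^V)\le\rho\le(1+\tau)\,r(G,B^V)$. -/

import Mathlib

namespace PresentBias

/-! ### Task graphs and agents -/

/-- A task graph: a directed acyclic graph with terminals `s` and `t` and non-negative edge costs,
all of whose nodes lie on a path from `s` to `t`.  (Values of `cost` at non-edges are never used.) -/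
structure TaskGraph (V : Type*) where
  E : V → V → Prop
  s : V
  t : V
  cost : V → V → ℝ
  cost_nonneg : ∀ v w, E v w → 0 ≤ cost v w
  acyclic : ∀ v, ¬ Relation.TransGen E v v
  from_s : ∀ v, Relation.ReflTransGen E s v
  to_t : ∀ v, Relation.ReflTransGen E v t

/-- The edges of a path that is given as the list of its nodes. -/
def pathEdges {V : Type*} (p : List V) : List (V × V) := p.zip p.tail

/-- Maximum of a list of non-negative numbers (`0` for the empty list). -/
noncomputable def maxOf (l : List ℝ) : ℝ := l.foldr max 0

namespace TaskGraph

variable {V : Type*} (G : TaskGraph V)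

/-- `p` is (the node list of) a path from `u` to `v`. -/
def IsPath (p : List V) (u v : V) : Prop :=
  p.IsChain G.E ∧ p.head? = some u ∧ p.getLast? = some v

/-- `d(w)`: the cost of a cheapest path from `w` to `t`, for the edge costs `c`. -/
noncomputable def dist (c : V → V → ℝ) (w : V) : ℝ :=
  sInf {x | ∃ p, G.IsPath p w G.t ∧ x = ((pathEdges p).map fun e => c e.1 e.2).sum}

/-- `d_β(v,w) = c(v,w) + β d(w)`: the perceived cost of an edge. -/
noncomputable def perceived (c : V → V → ℝ) (β : ℝ) (v w : V) : ℝ :=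
  c v w + β * G.dist c w

/-- `d_β(v)`: the minimum perceived cost at a node. -/
noncomputable def minPerceived (c : V → V → ℝ) (β : ℝ) (v : V) : ℝ :=
  sInf {x | ∃ w, G.E v w ∧ x = G.perceived c β v w}

/-- The agent, whose present bias at `v` is `β v`, may move from `v` to `w` when the reward is `r`:
she does not quit at `v`, and the edge minimizes her perceived cost. -/
def Step (c : V → V → ℝ) (β : V → ℝ) (r : ℝ) (v w : V) : Prop :=
  v ≠ G.t ∧ G.minPerceived c (β v) v ≤ β v * r ∧
    G.E v w ∧ G.perceived c (β v) v w = G.minPerceived c (β v) v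

/-- The graph with edge costs `c` is motivating for the present bias configuration `β` and the
reward `r`: however ties are broken, the agent does not quit at any node that she visits. -/
def Motivating (c : V → V → ℝ) (β : V → ℝ) (r : ℝ) : Prop :=
  ∀ v, Relation.ReflTransGen (G.Step c β r) G.s v → v ≠ G.t →
    G.minPerceived c (β v) v ≤ β v * r

/-- A cost configuration assigns a non-negative extra cost to every edge. -/
def IsCostConfig (f : V → V → ℝ) : Prop := ∀ v w, G.E v w → 0 ≤ f v w

/-- The cost configuration `f` is motivating, at reward `r`, for all `β ∈ B^V`. -/
def MotivatesAll (B : Set ℝ) (f : V → V → ℝ) (r : ℝ) : Prop :=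
  ∀ β : V → ℝ, (∀ v, β v ∈ B) → G.Motivating (fun v w => G.cost v w + f v w) β r

/-- `r(G, B^V)`: the infimum over all rewards that admit a cost configuration motivating for all
present bias configurations `β ∈ B^V`. -/
noncomputable def optReward (B : Set ℝ) : ℝ :=
  sInf {r | 0 ≤ r ∧ ∃ f, G.IsCostConfig f ∧ G.MotivatesAll B f r}

/-! ### The approximation algorithm -/

/-- `max {d_b(e) | e ∈ P}`, with respect to the original costs. -/
noncomputable def bottleneck (b : ℝ) (P : List V) : ℝ :=
  maxOf ((pathEdges P).map fun e => G.perceived G.cost b e.1 e.2)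

/-- `P` is a minmax path from `s` to `t` with respect to `d_b(e)`. -/
def IsMinmaxPath (b : ℝ) (P : List V) : Prop :=
  G.IsPath P G.s G.t ∧ ∀ Q, G.IsPath Q G.s G.t → G.bottleneck b P ≤ G.bottleneck b Q

/-- `ς v` is a successor of `v` on a cheapest path from `v` to `t`, for every `v ≠ t`. -/
def IsCheapestSucc (ς : V → V) : Prop :=
  ∀ v, v ≠ G.t → G.E v (ς v) ∧ G.cost v (ς v) + G.dist G.cost (ς v) = G.dist G.cost v

/-- Cost of a most expensive edge on the path `v, ς v, ς (ς v), …` between `v` and the first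
node different from `v` (i.e. after at least one step) that lies on `P` again. -/
noncomputable def detourMax (P : List V) (ς : V → V) (v : V) : ℝ :=
  maxOf ((List.range (sInf {k : ℕ | 0 < k ∧ ς^[k] v ∈ P})).map
    fun i => G.cost (ς^[i] v) (ς^[i + 1] v))

open Classical in
/-- The extra costs returned by the algorithm run with the minmax path `P` and the cheapest path
successors `ς`, where `b = min B` and `τ` is the range of `B`. -/
noncomputable def algFees (b τ : ℝ) (P : List V) (ς : V → V) (v w : V) : ℝ :=
  if (v, w) ∈ pathEdges P then 0
  else if w = ς v then
    if v ∈ P ∧ w ∉ P then τ * G.detourMax P ς v else 0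
  else (1 + τ) * G.bottleneck b P / b + 1

end TaskGraph

/-! ### Present bias sets -/

/-- A present bias set is described by a nonempty finite list of nonempty closed subintervals
of `(0,1]`. -/
def ValidIntervals {K : Type*} [Field K] [LinearOrder K] (L : List (K × K)) : Prop :=
  L ≠ [] ∧ ∀ J ∈ L, 0 < J.1 ∧ J.1 ≤ J.2 ∧ J.2 ≤ 1

/-- The union of the closed intervals in a list. -/
def unionOf (L : List (ℝ × ℝ)) : Set ℝ := {x | ∃ J ∈ L, x ∈ Set.Icc J.1 J.2}

/-- `B` is a present bias set. -/
def IsBiasSet (B : Set ℝ) : Prop := ∃ L : List (ℝ × ℝ), ValidIntervals L ∧ B = unionOf L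

/-- The range `τ = max B / min B` of a present bias set. -/
noncomputable def range (B : Set ℝ) : ℝ := sSup B / sInf B

/-! ### Random access machines with logarithmic cost

The memory consists of arrays of rational numbers (cell `i` of array `a` holds `σ a i`).  A program
names finitely many arrays; cells are addressed by computed indices.  Every value that occurs in a
computation is charged its bit length, so a step that handles numbers with `m` bits costs at
least `m`. -/

/-- Bit length of a rational number (numerator and denominator in lowest terms). -/
def bits (q : ℚ) : ℕ := Nat.size q.num.natAbs + Nat.size q.den

/-- Memory contents. -/
abbrev Mem := ℕ → ℕ → ℚ

/-- Arithmetic expressions. -/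
inductive Term where
  | const (q : ℚ)
  | read (a : ℕ) (i : Term)
  | add (x y : Term)
  | sub (x y : Term)
  | mul (x y : Term)
  | div (x y : Term)
  | le (x y : Term)

namespace Term

/-- Value of an expression; an index is rounded down to a natural number, division by zero
gives zero, and a comparison gives `1` (true) or `0` (false). -/
def eval (σ : Mem) : Term → ℚ
  | const q => q
  | read a i => σ a ⌊i.eval σ⌋₊
  | add x y => x.eval σ + y.eval σ
  | sub x y => x.eval σ - y.eval σ
  | mul x y => x.eval σ * y.eval σ
  | div x y => x.eval σ / y.eval σ
  | le x y => if x.eval σ ≤ y.eval σ then 1 else 0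

/-- Cost of evaluating an expression: the bit lengths of the values of all its subexpressions. -/
def cost (σ : Mem) : Term → ℕ
  | const q => bits q
  | read a i => i.cost σ + bits ((read a i).eval σ)
  | add x y => x.cost σ + y.cost σ + bits ((add x y).eval σ)
  | sub x y => x.cost σ + y.cost σ + bits ((sub x y).eval σ)
  | mul x y => x.cost σ + y.cost σ + bits ((mul x y).eval σ)
  | div x y => x.cost σ + y.cost σ + bits ((div x y).eval σ)
  | le x y => x.cost σ + y.cost σ + bits ((le x y).eval σ)

end Term

/-- Programs.  `write a i x` stores the value of `x` in cell `i` of array `a`. -/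
inductive Prog where
  | skip
  | write (a : ℕ) (i x : Term)
  | seq (p q : Prog)
  | ite (x : Term) (p q : Prog)
  | while (x : Term) (p : Prog)

/-- Memory after storing `q` in cell `i` of array `a`. -/
def Mem.store (σ : Mem) (a i : ℕ) (q : ℚ) : Mem :=
  Function.update σ a (Function.update (σ a) i q)

/-- `Exec p σ σ' k`: the program `p`, started with memory `σ`, terminates with memory `σ'` after
computation steps of total cost `k`. -/
inductive Exec : Prog → Mem → Mem → ℕ → Prop where
  | skip (σ) : Exec .skip σ σ 1
  | write (a i x σ) :
      Exec (.write a i x) σ (σ.store a ⌊i.eval σ⌋₊ (x.eval σ)) (i.cost σ + x.cost σ + 1)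
  | seq {p q σ₁ σ₂ σ₃ k l} : Exec p σ₁ σ₂ k → Exec q σ₂ σ₃ l → Exec (.seq p q) σ₁ σ₃ (k + l)
  | ite_true {x p q σ₁ σ₂ k} : x.eval σ₁ ≠ 0 → Exec p σ₁ σ₂ k →
      Exec (.ite x p q) σ₁ σ₂ (x.cost σ₁ + k)
  | ite_false {x p q σ₁ σ₂ k} : x.eval σ₁ = 0 → Exec q σ₁ σ₂ k →
      Exec (.ite x p q) σ₁ σ₂ (x.cost σ₁ + k)
  | while_true {x p σ₁ σ₂ σ₃ k l} : x.eval σ₁ ≠ 0 → Exec p σ₁ σ₂ k →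
      Exec (.while x p) σ₂ σ₃ l → Exec (.while x p) σ₁ σ₃ (x.cost σ₁ + k + l)
  | while_false {x p σ} : x.eval σ = 0 → Exec (.while x p) σ σ (x.cost σ)

/-- Initial memory for an input that consists of finitely many lists: list number `a` is stored
in array `a`, and all other cells are zero. -/
def initMem (L : List (List ℚ)) : Mem := fun a i => (L.getD a []).getD i 0

/-- Bit length of an input. -/
def inputSize (L : List (List ℚ)) : ℕ := (L.map fun l => (l.map bits).sum).sum

/-! ### Instances as inputs -/

/-- A VPB-OPT instance that can be given to a machine: a task graph on `n` nodes with rational edge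
costs, and a present bias set given by intervals with rational end points. -/
structure Instance where
  n : ℕ
  G : TaskGraph (Fin n)
  c : Fin n → Fin n → ℚ
  cost_eq : ∀ v w, G.E v w → G.cost v w = c v w
  intervals : List (ℚ × ℚ)
  valid : ValidIntervals intervals

namespace Instance

/-- The present bias set of an instance. -/
def B (I : Instance) : Set ℝ := unionOf (I.intervals.map fun J => ((J.1 : ℝ), (J.2 : ℝ)))

open Classical in
/-- The input: array 0 holds the number of nodes, `s`, `t` and the number of intervals; array 1
the adjacency matrix and array 2 the cost matrix, row by row; array 3 the interval end points. -/
noncomputable def encode (I : Instance) : List (List ℚ) :=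
  [[(I.n : ℚ), (I.G.s : ℕ), (I.G.t : ℕ), (I.intervals.length : ℚ)],
   List.ofFn fun k : Fin (I.n * I.n) => if I.G.E k.divNat k.modNat then 1 else 0,
   List.ofFn fun k : Fin (I.n * I.n) =>
     if I.G.E k.divNat k.modNat then I.c k.divNat k.modNat else 0,
   I.intervals.flatMap fun J => [J.1, J.2]]

/-- The output: the extra costs are found in array 4, as a matrix given row by row. -/
def outFees (I : Instance) (σ : Mem) (v w : Fin I.n) : ℝ :=
  (σ 4 ((v : ℕ) * I.n + (w : ℕ)) : ℚ)

/-- The output: the reward is found in cell 0 of array 5. -/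
def outReward (_I : Instance) (σ : Mem) : ℝ := (σ 5 0 : ℚ)

end Instance

end PresentBias

/-!
**The guarantee.** Write `r = (1 + τ) * α / b`, and let `d` and `d'` be the distances to `t` for the
original and for the increased costs.

*The extra costs are motivating* (`TaskGraph.motivating_algFees`).  An edge outside `P ∪ T` costs
more than `r`, so an agent who does not quit never takes it.  On `P` she can continue along `P`:
the cheapest path from a node of `P` pays, for each of its detours from `P`, at most `τ` times the
cost of that detour, so that `d' ≤ (1 + τ) * d` on `P` (`TaskGraph.dist_algFees_le`), and an edge
of `P` has a perceived cost of at most `β * r` because `β ≥ b`.  If she leaves `P` through an edge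
`(v, w)` of `T`, then she was willing to pay `τ` times the cost `M` of the most expensive edge of
the detour immediately; since her present bias is at most `τ * b`, this means `M ≤ b * (r - d' w)`.
Along the detour `d'` decreases, so she is also willing to pay for every edge of it, whatever her
present bias is there.

*The lower bound* (`TaskGraph.exists_bottleneck_le`).  If some extra costs are motivating at reward
`r`, then an agent with constant present bias `b` walks along a path all of whose edges have a
perceived cost of at most `b * r`.  Hence `α ≤ b * r`.

**The running time.**  A program is verified together with its running time.  The sizes of numbers
are controlled by `Limits.Small`: with respect to a common denominator `N` of all numbers in the
input and of their inverses, they are multiples of `1 / N ^ k` and at most `2 ^ (k * (X + 1))`,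
where `X` is the input size.  If all memory cells are of bounded level `k`, then evaluating a fixed
expression costs `O(X)`.  A program whose loops are iterated at most `X` times hence takes time
`O(X)` times `Prog.time`, a polynomial that depends on the program only.  `Prog.Reaches` bundles
termination within this time, bounded memory and a postcondition; it has one rule for every kind of
statement, the rule for counting loops being `Prog.reaches_loop`.

Distances and minmax paths satisfy Bellman equations `val v = min (F v w (val w))` over the edges
`(v, w)`, with `val t = 0` (`TaskGraph.IsValue`), so that both are computed by the same
Bellman-Ford program (`Prog.reaches_bellmanFord`).  The number of nodes that are reachable from `v`
decreases along the edges of an acyclic graph, so after `k` rounds all nodes with fewer than `k`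
reachable ones have their final values, and `n` rounds suffice for `n` nodes.
-/

namespace PresentBias

/-! ### Paths and dynamic programming on a task graph -/

/-- The value obtained by processing the edges of the path `p` from its end, starting with `0`,
where crossing the edge `(v, w)` turns the value `x` at `w` into `F v w x`.  Lengths of paths and
bottlenecks of paths are both of this form. -/
def foldPath {V α : Type*} [Zero α] (F : V → V → α → α) (p : List V) : α :=
  (pathEdges p).foldr (fun e x => F e.1 e.2 x) 0

theorem pathEdges_cons {V : Type*} {p : List V} {w : V} (v : V) (hp : p.head? = some w) :
    pathEdges (v :: p) = (v, w) :: pathEdges p := by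
  cases p with
  | nil => simp at hp
  | cons a l => simp at hp; subst hp; rfl

theorem foldPath_cons {V α : Type*} [Zero α] (F : V → V → α → α) {p : List V} {w : V} (v : V)
    (hp : p.head? = some w) : foldPath F (v :: p) = F v w (foldPath F p) := by
  simp [foldPath, pathEdges_cons v hp]

theorem maxOf_le_iff {l : List ℝ} {x : ℝ} : maxOf l ≤ x ↔ 0 ≤ x ∧ ∀ y ∈ l, y ≤ x := by
  induction l with
  | nil => simp [maxOf]
  | cons a l ih =>
    have : maxOf (a :: l) = max a (maxOf l) := rfl
    rw [this, max_le_iff, ih]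
    simp; tauto

theorem maxOf_nonneg (l : List ℝ) : 0 ≤ maxOf l := (maxOf_le_iff.1 le_rfl).1

theorem le_maxOf {l : List ℝ} {y : ℝ} (hy : y ∈ l) : y ≤ maxOf l := (maxOf_le_iff.1 le_rfl).2 y hy

namespace TaskGraph

variable {V : Type*} (G : TaskGraph V)

theorem not_edge_t (v : V) : ¬ G.E G.t v := fun h =>
  G.acyclic G.t (Relation.TransGen.head' h (G.to_t v))

theorem ne_t_of_edge {v w : V} (h : G.E v w) : v ≠ G.t := by
  rintro rfl; exact G.not_edge_t w h

theorem exists_edge {v : V} (hv : v ≠ G.t) : ∃ w, G.E v w := by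
  rcases (G.to_t v).cases_head with h | ⟨w, h, _⟩
  · exact absurd h hv
  · exact ⟨w, h⟩

/-- The number of nodes reachable from a node by at least one edge decreases along all edges. -/
theorem exists_rank [Finite V] :
    ∃ h : V → ℕ, (∀ v w, G.E v w → h w < h v) ∧ ∀ v, h v < Nat.card V := by
  refine ⟨fun v => {u | Relation.TransGen G.E v u}.ncard, fun v w hvw => ?_, fun v => ?_⟩
  · apply Set.ncard_lt_ncard _ (Set.toFinite _)
    refine ⟨fun u hu => Relation.TransGen.head hvw hu, fun hsub => ?_⟩
    exact G.acyclic w (hsub (Relation.TransGen.single hvw))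
  · rw [← Set.ncard_univ]
    apply Set.ncard_lt_ncard _ (Set.toFinite _)
    refine ⟨fun u _ => trivial, fun hsub => G.acyclic v (hsub (Set.mem_univ v))⟩

/-- Induction along the edges, from `t` backwards. -/
theorem reverse_induction [Finite V] {p : V → Prop} (ht : p G.t)
    (hp : ∀ v, v ≠ G.t → (∀ w, G.E v w → p w) → p v) (v : V) : p v := by
  obtain ⟨h, hlt, -⟩ := G.exists_rank
  induction hn : h v using Nat.strong_induction_on generalizing v with
  | _ n ih =>
    by_cases hv : v = G.t
    · rwa [hv]
    · exact hp v hv fun w hw => ih _ (hn ▸ hlt v w hw) w rfl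

theorem isPath_t : G.IsPath [G.t] G.t G.t := by simp [IsPath]

variable {G} in
theorem IsPath.cons {v w u : V} {p : List V} (h : G.E v w) (hp : G.IsPath p w u) :
    G.IsPath (v :: p) v u := by
  obtain ⟨h1, h2, h3⟩ := hp
  cases p with
  | nil => simp at h2
  | cons a l =>
    simp at h2; subst h2
    exact ⟨by simp [h, h1], by simp, by simpa using h3⟩

variable {G} in
theorem IsPath.cases_t {v : V} {p : List V} (hp : G.IsPath p v G.t) :
    (v = G.t ∧ p = [v]) ∨ ∃ w q, G.E v w ∧ G.IsPath q w G.t ∧ p = v :: q := by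
  obtain ⟨h1, h2, h3⟩ := hp
  match p, h1, h2, h3 with
  | [], _, h2, _ => simp at h2
  | [a], _, h2, h3 => simp at h2 h3; subst h2; exact .inl ⟨h3, rfl⟩
  | a :: c :: l, h1, h2, h3 =>
    simp at h1 h2; subst h2
    exact .inr ⟨c, c :: l, h1.1, ⟨h1.2, by simp, by simpa using h3⟩, rfl⟩

variable {G} in
/-- Induction on a path to `t`, from its end. -/
theorem IsPath.induct_t {motive : ∀ v p, G.IsPath p v G.t → Prop}
    (base : motive G.t [G.t] G.isPath_t)
    (step : ∀ v w q (hE : G.E v w) (hq : G.IsPath q w G.t), motive w q hq →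
      motive v (v :: q) (hq.cons hE))
    {v : V} {p : List V} (hp : G.IsPath p v G.t) : motive v p hp := by
  induction hn : p.length using Nat.strong_induction_on generalizing v p with
  | _ n ih =>
    rcases hp.cases_t with ⟨rfl, rfl⟩ | ⟨w, q, hE, hq, rfl⟩
    · exact base
    · exact step v w q hE hq (ih _ (by simp at hn; omega) hq rfl)

variable {G} in
theorem IsPath.t_mem {v : V} {p : List V} (hp : G.IsPath p v G.t) : G.t ∈ p :=
  List.mem_of_getLast? hp.2.2

variable {G} in
theorem IsPath.start_mem {v u : V} {p : List V} (hp : G.IsPath p v u) : v ∈ p :=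
  List.mem_of_mem_head? hp.2.1

variable {G} in
theorem IsPath.of_mem_pathEdges {u v w : V} {p : List V} (hp : G.IsPath p u G.t)
    (h : (v, w) ∈ pathEdges p) : v ∈ p ∧ w ∈ p ∧ G.E v w := by
  induction hp using IsPath.induct_t with
  | base => simp [pathEdges] at h
  | step u' w' q hE hq ih =>
    rw [pathEdges_cons _ hq.2.1, List.mem_cons] at h
    rcases h with h | h
    · simp at h; obtain ⟨rfl, rfl⟩ := h
      exact ⟨by simp, List.mem_cons_of_mem _ hq.start_mem, hE⟩
    · obtain ⟨h1, h2, h3⟩ := ih h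
      exact ⟨List.mem_cons_of_mem _ h1, List.mem_cons_of_mem _ h2, h3⟩

variable {G} in
theorem IsPath.exists_mem_pathEdges {u v : V} {p : List V} (hp : G.IsPath p u G.t)
    (hv : v ∈ p) (hvt : v ≠ G.t) : ∃ w, (v, w) ∈ pathEdges p := by
  induction hp using IsPath.induct_t with
  | base => simp at hv; exact absurd hv hvt
  | step u' w' q hE hq ih =>
    rw [pathEdges_cons _ hq.2.1]
    rcases List.mem_cons.1 hv with rfl | hv
    · exact ⟨w', by simp⟩
    · obtain ⟨w, hw⟩ := ih hv
      exact ⟨w, List.mem_cons_of_mem _ hw⟩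

/-- Bellman's equations: `val v` is the minimum of `F v w (val w)` over the edges `(v, w)`,
and `val t = 0`. -/
structure IsValue {α : Type*} [LinearOrder α] [Zero α] (F : V → V → α → α) (val : V → α) :
    Prop where
  val_t : val G.t = 0
  le : ∀ v w, G.E v w → val v ≤ F v w (val w)
  exists_eq : ∀ v, v ≠ G.t → ∃ w, G.E v w ∧ F v w (val w) = val v

/-- Bellman's equations have a solution, which is constructed by increasing rank. -/
theorem exists_isValue [Finite V] {α : Type*} [LinearOrder α] [Zero α] (F : V → V → α → α) :
    ∃ val, G.IsValue F val := by
  obtain ⟨h, hlt, hcard⟩ := G.exists_rank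
  have key : ∀ k, ∃ val : V → α, val G.t = 0 ∧ ∀ v, v ≠ G.t → h v < k →
      (∀ w, G.E v w → val v ≤ F v w (val w)) ∧ ∃ w, G.E v w ∧ F v w (val w) = val v := by
    intro k
    induction k with
    | zero => exact ⟨fun _ => 0, rfl, by simp⟩
    | succ k ih =>
      obtain ⟨val, h0, hval⟩ := ih
      have hmin : ∀ v, v ≠ G.t → ∃ w, G.E v w ∧ ∀ w', G.E v w' → F v w (val w) ≤ F v w' (val w') :=
        fun v hv => Set.exists_min_image {w | G.E v w} (fun w => F v w (val w)) (Set.toFinite _)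
          (G.exists_edge hv)
      choose! g hg hgmin using hmin
      classical
      let val' : V → α := fun v => if h v = k ∧ v ≠ G.t then F v (g v) (val (g v)) else val v
      have hold : ∀ v, h v < k → val' v = val v := fun v hv => if_neg (by omega)
      refine ⟨val', by simp [val', h0], fun v hv hk => ?_⟩
      have hsucc : ∀ w, G.E v w → val' w = val w := fun w hw =>
        hold w (by have := hlt v w hw; omega)
      rcases Nat.lt_succ_iff_lt_or_eq.1 hk with hk | hk
      · obtain ⟨h1, w, hw, h2⟩ := hval v hv hk
        rw [hold v hk]
        exact ⟨fun w hw => by rw [hsucc w hw]; exact h1 w hw, w, hw, by rw [hsucc w hw, h2]⟩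
      · have hv' : val' v = F v (g v) (val (g v)) := if_pos ⟨hk, hv⟩
        rw [hv']
        exact ⟨fun w hw => by rw [hsucc w hw]; exact hgmin v hv w hw, g v, hg v hv,
          by rw [hsucc _ (hg v hv)]⟩
  obtain ⟨val, h0, hval⟩ := key (Nat.card V)
  exact ⟨val, h0, fun v w hw => (hval v (G.ne_t_of_edge hw) (hcard v)).1 w hw,
    fun v hv => (hval v hv (hcard v)).2⟩

variable {G} in
/-- A solution of Bellman's equations bounds the value of every path from below. -/
theorem IsValue.le_foldPath {α : Type*} [LinearOrder α] [Zero α] {F : V → V → α → α} {val : V → α}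
    (h : G.IsValue F val) (hF : ∀ v w, Monotone (F v w)) {p : List V} {v : V}
    (hp : G.IsPath p v G.t) : val v ≤ foldPath F p := by
  induction hp using IsPath.induct_t with
  | base => simp [foldPath, pathEdges, h.val_t]
  | step v w q hE hq ih =>
    rw [foldPath_cons _ _ hq.2.1]
    exact (h.le v w hE).trans (hF v w ih)

/-- The path along the pointers `next`.  If the pointers attain the minima in Bellman's
equations, then its value is optimal. -/
theorem exists_followPath [Finite V] {next : V → V} (hnext : ∀ v, v ≠ G.t → G.E v (next v))
    (u : V) :
    ∃ P, G.IsPath P u G.t ∧ (∀ v w, (v, w) ∈ pathEdges P ↔ v ∈ P ∧ v ≠ G.t ∧ w = next v) ∧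
      (next G.t = G.t → ∀ v, v ∈ P ↔ ∃ k, next^[k] u = v) ∧
      ∀ (F : V → V → ℝ → ℝ) (val : V → ℝ), val G.t = 0 →
        (∀ v, v ≠ G.t → F v (next v) (val (next v)) = val v) → foldPath F P = val u := by
  induction u using G.reverse_induction with
  | ht =>
    refine ⟨[G.t], G.isPath_t, fun v w => ?_, fun h v => ?_, fun F val h _ => ?_⟩
    · simp [pathEdges]; tauto
    · simp [Function.iterate_fixed h, eq_comm]
    · simp [foldPath, pathEdges, h]
  | hp u hu ih =>
    obtain ⟨P, hP, hedge, hmem, hval⟩ := ih _ (hnext u hu)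
    refine ⟨u :: P, hP.cons (hnext u hu), fun v w => ?_, fun h v => ?_, fun F val h0 h1 => ?_⟩
    · rw [pathEdges_cons _ hP.2.1, List.mem_cons, hedge, List.mem_cons, Prod.mk.injEq]
      constructor
      · rintro (⟨rfl, rfl⟩ | h)
        · exact ⟨.inl rfl, hu, rfl⟩
        · exact ⟨.inr h.1, h.2⟩
      · rintro ⟨rfl | h, h2, h3⟩
        · exact .inl ⟨rfl, h3⟩
        · exact .inr ⟨h, h2, h3⟩
    · rw [List.mem_cons, hmem h]
      constructor
      · rintro (rfl | ⟨k, hk⟩)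
        · exact ⟨0, rfl⟩
        · exact ⟨k + 1, by simpa using hk⟩
      · rintro ⟨k, hk⟩
        cases k with
        | zero => exact .inl hk.symm
        | succ k => exact .inr ⟨k, by simpa using hk⟩
    · rw [foldPath_cons _ _ hP.2.1, hval F val h0 h1, h1 u hu]

/-! ### Distances, perceived costs and bottlenecks -/

theorem sum_eq_foldPath (c : V → V → ℝ) (p : List V) :
    ((pathEdges p).map fun e => c e.1 e.2).sum = foldPath (fun v w x => c v w + x) p := by
  rw [List.sum_eq_foldr, List.foldr_map]; rfl

theorem bottleneck_eq_foldPath (b : ℝ) (p : List V) :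
    G.bottleneck b p = foldPath (fun v w x => max (G.perceived G.cost b v w) x) p := by
  rw [bottleneck, maxOf, List.foldr_map]; rfl

variable {G} in
theorem IsValue.eq_dist [Finite V] {c : V → V → ℝ} {val : V → ℝ}
    (h : G.IsValue (fun v w x => c v w + x) val) : val = G.dist c := by
  funext v
  choose! next hnext heq using h.exists_eq
  obtain ⟨P, hP, -, -, hv⟩ := G.exists_followPath hnext v
  symm
  refine IsLeast.csInf_eq ⟨⟨P, hP, ?_⟩, ?_⟩
  · rw [sum_eq_foldPath, hv _ val h.val_t heq]
  · rintro _ ⟨p, hp, rfl⟩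
    rw [sum_eq_foldPath]
    exact h.le_foldPath (fun v w x y hxy => by simpa using hxy) hp

theorem isValue_dist [Finite V] (c : V → V → ℝ) :
    G.IsValue (fun v w x => c v w + x) (G.dist c) := by
  obtain ⟨val, h⟩ := G.exists_isValue (fun v w x => c v w + x)
  rwa [← h.eq_dist]

variable {G} in
theorem IsValue.isMinmaxPath {b : ℝ} {val : V → ℝ}
    (h : G.IsValue (fun v w x => max (G.perceived G.cost b v w) x) val) {P : List V}
    (hP : G.IsPath P G.s G.t) (hval : G.bottleneck b P = val G.s) : G.IsMinmaxPath b P := by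
  refine ⟨hP, fun Q hQ => ?_⟩
  rw [hval, bottleneck_eq_foldPath]
  exact h.le_foldPath (fun v w x y hxy => max_le_max le_rfl hxy) hQ

theorem exists_isMinmaxPath [Finite V] (b : ℝ) : ∃ P, G.IsMinmaxPath b P := by
  obtain ⟨val, h⟩ := G.exists_isValue (fun v w x => max (G.perceived G.cost b v w) x)
  choose! next hnext heq using h.exists_eq
  obtain ⟨P, hP, -, -, hv⟩ := G.exists_followPath hnext G.s
  exact ⟨P, h.isMinmaxPath hP (by rw [bottleneck_eq_foldPath, hv _ val h.val_t heq])⟩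

theorem exists_isCheapestSucc [Finite V] : ∃ ς, G.IsCheapestSucc ς := by
  have h := (G.isValue_dist G.cost).exists_eq
  choose! next hnext heq using h
  exact ⟨next, fun v hv => ⟨hnext v hv, heq v hv⟩⟩

theorem dist_nonneg [Finite V] {c : V → V → ℝ} (hc : ∀ v w, G.E v w → 0 ≤ c v w) (v : V) :
    0 ≤ G.dist c v := by
  have h := G.isValue_dist c
  induction v using G.reverse_induction with
  | ht => exact h.val_t.ge
  | hp v hv ih =>
    obtain ⟨w, hw, he⟩ := h.exists_eq v hv
    rw [← he]
    exact add_nonneg (hc v w hw) (ih w hw)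

theorem dist_mono [Finite V] {c c' : V → V → ℝ} (hc : ∀ v w, G.E v w → c v w ≤ c' v w) (v : V) :
    G.dist c v ≤ G.dist c' v := by
  have h := G.isValue_dist c
  have h' := G.isValue_dist c'
  induction v using G.reverse_induction with
  | ht => rw [h.val_t, h'.val_t]
  | hp v hv ih =>
    obtain ⟨w, hw, he⟩ := h'.exists_eq v hv
    rw [← he]
    exact (h.le v w hw).trans (add_le_add (hc v w hw) (ih w hw))

theorem minPerceived_le [Finite V] (c : V → V → ℝ) (β : ℝ) {v w : V} (h : G.E v w) :
    G.minPerceived c β v ≤ G.perceived c β v w := by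
  refine csInf_le ?_ ⟨w, h, rfl⟩
  refine ((Set.toFinite {w | G.E v w}).image (G.perceived c β v)).bddBelow.mono ?_
  rintro _ ⟨w, hw, rfl⟩
  exact ⟨w, hw, rfl⟩

theorem exists_eq_minPerceived [Finite V] (c : V → V → ℝ) (β : ℝ) {v : V} (hv : v ≠ G.t) :
    ∃ w, G.E v w ∧ G.perceived c β v w = G.minPerceived c β v := by
  obtain ⟨w, hw, hmin⟩ := Set.exists_min_image {w | G.E v w} (G.perceived c β v) (Set.toFinite _)
    (G.exists_edge hv)
  refine ⟨w, hw, ?_⟩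
  symm
  refine IsLeast.csInf_eq ⟨⟨w, hw, rfl⟩, ?_⟩
  rintro _ ⟨w', hw', rfl⟩
  exact hmin w' hw'

/-! ### Lower bound on the optimal reward -/

/-- An agent whose present bias is constantly `b` walks along a path whose edges have a perceived
cost of at most `b * r`. -/
theorem exists_bottleneck_le [Finite V] {f : V → V → ℝ} (hf : G.IsCostConfig f) {b r : ℝ}
    (hb : 0 ≤ b) (hr : 0 ≤ r)
    (hm : G.Motivating (fun v w => G.cost v w + f v w) (fun _ => b) r) :
    ∃ Q, G.IsPath Q G.s G.t ∧ G.bottleneck b Q ≤ b * r := by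
  set c := fun v w => G.cost v w + f v w
  have key : ∀ v, Relation.ReflTransGen (G.Step c (fun _ => b) r) G.s v →
      ∃ Q, G.IsPath Q v G.t ∧ G.bottleneck b Q ≤ b * r := by
    intro v
    induction v using G.reverse_induction with
    | ht =>
      refine fun _ => ⟨[G.t], G.isPath_t, ?_⟩
      simpa [bottleneck, pathEdges, maxOf] using mul_nonneg hb hr
    | hp v hv ih =>
      intro hsv
      obtain ⟨w, hw, he⟩ := G.exists_eq_minPerceived c b hv
      have hle := hm v hsv hv
      obtain ⟨Q, hQ, hQle⟩ := ih w hw (hsv.tail ⟨hv, hle, hw, he⟩)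
      refine ⟨v :: Q, hQ.cons hw, ?_⟩
      rw [bottleneck_eq_foldPath] at hQle ⊢
      rw [foldPath_cons _ _ hQ.2.1]
      refine max_le (le_trans ?_ (he.trans_le hle)) hQle
      have h1 : G.cost v w ≤ c v w := by simpa [c] using hf v w hw
      have h2 : G.dist G.cost w ≤ G.dist c w :=
        G.dist_mono (fun v w h => by simpa [c] using hf v w h) w
      exact add_le_add h1 (mul_le_mul_of_nonneg_left h2 hb)
  exact key G.s .refl

/-! ### The extra costs of the algorithm -/

variable {G}

theorem bottleneck_nonneg (b : ℝ) (P : List V) : 0 ≤ G.bottleneck b P := maxOf_nonneg _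

theorem detourMax_nonneg (P : List V) (ς : V → V) (v : V) : 0 ≤ G.detourMax P ς v :=
  maxOf_nonneg _

theorem algFees_nonneg {b τ : ℝ} (hb : 0 < b) (hτ : 0 ≤ τ) (P : List V) (ς : V → V) (v w : V) :
    0 ≤ G.algFees b τ P ς v w := by
  have h1 := bottleneck_nonneg (G := G) b P
  have h2 := detourMax_nonneg (G := G) P ς v
  unfold algFees
  split_ifs <;> positivity

theorem algFees_succ_le {b τ : ℝ} (hτ : 0 ≤ τ) (P : List V) (ς : V → V) (v : V) :
    G.algFees b τ P ς v (ς v) ≤ τ * G.detourMax P ς v := by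
  have h2 := mul_nonneg hτ (detourMax_nonneg (G := G) P ς v)
  rw [algFees]
  split_ifs with h3 h4 h5
  exacts [h2, le_rfl, h2, absurd rfl h4]

theorem algFees_succ_of_notMem {b τ : ℝ} {P : List V} {ς : V → V} {v : V} (hv : v ∉ P) :
    G.algFees b τ P ς v (ς v) = 0 := by
  rw [algFees]
  split_ifs with h1 h2 h3
  exacts [rfl, absurd h3.1 hv, rfl, absurd rfl h2]

/-- Following cheapest paths, the agent returns to every path that ends in `t`. -/
theorem IsCheapestSucc.detour_spec [Finite V] {ς : V → V} (hς : G.IsCheapestSucc ς) {P : List V}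
    (htP : G.t ∈ P) {v : V} (hv : v ≠ G.t) :
    let k₀ := sInf {k : ℕ | 0 < k ∧ ς^[k] v ∈ P}
    0 < k₀ ∧ ς^[k₀] v ∈ P ∧ ∀ k, 0 < k → k < k₀ → ς^[k] v ∉ P := by
  have hreach : ∀ v, ∃ k, ς^[k] v = G.t := by
    intro v
    induction v using G.reverse_induction with
    | ht => exact ⟨0, rfl⟩
    | hp v hv ih =>
      obtain ⟨k, hk⟩ := ih _ (hς v hv).1
      exact ⟨k + 1, by simpa using hk⟩
  have hne : {k : ℕ | 0 < k ∧ ς^[k] v ∈ P}.Nonempty := by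
    obtain ⟨k, hk⟩ := hreach v
    refine ⟨k, Nat.pos_of_ne_zero ?_, by rwa [hk]⟩
    rintro rfl
    exact hv hk
  intro k₀
  have h := Nat.sInf_mem hne
  exact ⟨h.1, h.2, fun k hk hk₀ hmem => Nat.notMem_of_lt_sInf hk₀ ⟨hk, hmem⟩⟩

/-- On the minmax path, the extra costs increase the distance to `t` by a factor of at most
`1 + τ`: the cheapest path pays, for each of its detours from `P`, at most `τ` times the cost of
that detour. -/
theorem dist_algFees_le [Finite V] {b τ : ℝ} (hτ : 0 ≤ τ) {P : List V} {u : V}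
    (hP : G.IsPath P u G.t) {ς : V → V} (hς : G.IsCheapestSucc ς) {v : V} (hv : v ∈ P) :
    G.dist (fun v w => G.cost v w + G.algFees b τ P ς v w) v ≤ (1 + τ) * G.dist G.cost v := by
  set c := fun v w => G.cost v w + G.algFees b τ P ς v w with hc
  have hd := G.isValue_dist G.cost
  have hd' := G.isValue_dist c
  obtain ⟨h, hlt, -⟩ := G.exists_rank
  induction hn : h v using Nat.strong_induction_on generalizing v with
  | _ n ih =>
    by_cases hvt : v = G.t
    · rw [hvt, hd.val_t, hd'.val_t]; simp
    obtain ⟨hpos, hmem, hnot⟩ := hς.detour_spec hP.t_mem hvt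
    set k₀ := sInf {k : ℕ | 0 < k ∧ ς^[k] v ∈ P} with hk₀
    have hne : ∀ j, j < k₀ → ς^[j] v ≠ G.t := by
      intro j hj
      rcases Nat.eq_zero_or_pos j with rfl | hj0
      · exact hvt
      · intro he; exact hnot j hj0 hj (he ▸ hP.t_mem)
    have hstep : ∀ j, j < k₀ → G.E (ς^[j] v) (ς^[j + 1] v) ∧
        G.cost (ς^[j] v) (ς^[j + 1] v) + G.dist G.cost (ς^[j + 1] v) = G.dist G.cost (ς^[j] v) := by
      intro j hj
      rw [Function.iterate_succ_apply']
      exact hς _ (hne j hj)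
    have hanti : ∀ i j, i ≤ j → j ≤ k₀ → G.dist G.cost (ς^[j] v) ≤ G.dist G.cost (ς^[i] v) := by
      intro i j hij
      induction hij with
      | refl => exact fun _ => le_rfl
      | step hij ih' =>
        intro hj
        have h1 := hstep _ hj
        have h2 := G.cost_nonneg _ _ h1.1
        have h3 := ih' (Nat.le_of_succ_le hj)
        simp only [Nat.succ_eq_add_one] at *
        linarith [h1.2]
    have hM : G.detourMax P ς v ≤ G.dist G.cost v - G.dist G.cost (ς^[k₀] v) := by
      rw [detourMax, maxOf_le_iff]
      refine ⟨sub_nonneg.2 (hanti 0 k₀ (Nat.zero_le _) le_rfl), fun y hy => ?_⟩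
      simp only [List.mem_map, List.mem_range] at hy
      obtain ⟨i, hi, rfl⟩ := hy
      have h1 := hstep i hi
      have h2 := hanti 0 i (Nat.zero_le _) hi.le
      have h3 := hanti (i + 1) k₀ hi le_rfl
      simp only [Function.iterate_zero, id_eq] at h2
      linarith [h1.2]
    -- up to its first return to `P`, the cheapest path pays extra costs only on its first edge
    have htel : ∀ j, 0 < j → j ≤ k₀ → G.dist c v ≤ G.dist G.cost v - G.dist G.cost (ς^[j] v) +
        τ * G.detourMax P ς v + G.dist c (ς^[j] v) := by
      intro j hj
      induction j, hj using Nat.le_induction with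
      | base =>
        intro _
        have h1 := hd'.le v (ς v) (hς v hvt).1
        have h2 := (hς v hvt).2
        have h3 := algFees_succ_le (G := G) (b := b) hτ P ς v
        simp only [hc, Function.iterate_one] at h1 ⊢
        linarith
      | succ j hj ih' =>
        intro hj'
        have h1 := ih' (by omega)
        have h2 := hstep j hj'
        have h3 := hd'.le _ _ h2.1
        have h4 : c (ς^[j] v) (ς^[j + 1] v) = G.cost (ς^[j] v) (ς^[j + 1] v) := by
          simp only [hc]
          rw [Function.iterate_succ_apply', algFees_succ_of_notMem (hnot j hj hj'), add_zero]
        simp only [h4] at h3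
        linarith [h2.2]
    have hrank : ∀ j, 0 < j → j ≤ k₀ → h (ς^[j] v) < h v := by
      intro j hj
      induction j, hj using Nat.le_induction with
      | base => exact fun _ => hlt _ _ (hstep 0 hpos).1
      | succ j hj ih' => exact fun hj' => (hlt _ _ (hstep j hj').1).trans (ih' (by omega))
    have h1 := htel k₀ hpos le_rfl
    have h2 := ih _ (hn ▸ hrank k₀ hpos le_rfl) hmem rfl
    have h3 := mul_le_mul_of_nonneg_left hM hτ
    linarith

/-- The extra costs are motivating.  At a node `v` that is not on `P`, every edge that the agent
still has to take before she returns to `P` costs at most `b * (r - d(v))`, where `d` is the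
distance for the increased costs. -/
theorem motivating_algFees [Finite V] {b τ : ℝ} (hb : 0 < b) (hτ : 1 ≤ τ) {P : List V}
    (hP : G.IsPath P G.s G.t) {ς : V → V} (hς : G.IsCheapestSucc ς) {β : V → ℝ}
    (hβ : ∀ v, b ≤ β v ∧ β v ≤ τ * b ∧ β v ≤ 1) :
    G.Motivating (fun v w => G.cost v w + G.algFees b τ P ς v w) β
      ((1 + τ) * G.bottleneck b P / b) := by
  set c := fun v w => G.cost v w + G.algFees b τ P ς v w with hc
  set α := G.bottleneck b P with hα
  set r := (1 + τ) * α / b with hr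
  have hα0 : 0 ≤ α := bottleneck_nonneg b P
  have hr0 : 0 ≤ r := by positivity
  have hc0 : ∀ v w, G.E v w → 0 ≤ c v w := fun v w h =>
    add_nonneg (G.cost_nonneg v w h) (algFees_nonneg hb (by linarith) P ς v w)
  have hd0 := G.dist_nonneg hc0
  have hd := G.isValue_dist c
  have hbig : ∀ v w, G.E v w → (v, w) ∉ pathEdges P → w ≠ ς v → r < c v w := by
    intro v w hE h1 h2
    simp only [hc, algFees, if_neg h1, if_neg h2]
    linarith [G.cost_nonneg v w hE]
  have hβ0 : ∀ v, 0 < β v := fun v => hb.trans_le (hβ v).1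
  -- an edge that is neither on `P` nor the start of a cheapest path is never worth its price
  have hsucc : ∀ v w, G.E v w → G.perceived c (β v) v w ≤ β v * r → (v, w) ∉ pathEdges P →
      w = ς v := by
    intro v w hE hle h1
    by_contra h2
    have h3 := hbig v w hE h1 h2
    have h4 := mul_nonneg (hβ0 v).le (hd0 w)
    have h5 := mul_le_mul_of_nonneg_right (hβ v).2.2 hr0
    unfold perceived at hle
    linarith
  -- the invariant of the nodes that the agent visits
  let I : V → Prop := fun v => v ∈ P ∨ (v ∉ P ∧ ∀ j, (∀ i ≤ j, ς^[i] v ∉ P) →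
    G.cost (ς^[j] v) (ς^[j + 1] v) ≤ b * (r - G.dist c v))
  have hquit : ∀ v, I v → v ≠ G.t → G.minPerceived c (β v) v ≤ β v * r := by
    rintro v (hv | ⟨hv, hI⟩) hvt
    · obtain ⟨w, hw⟩ := hP.exists_mem_pathEdges hv hvt
      obtain ⟨-, hwP, hE⟩ := hP.of_mem_pathEdges hw
      refine (G.minPerceived_le c (β v) hE).trans ?_
      have h1 : G.perceived G.cost b v w ≤ α :=
        le_maxOf (List.mem_map.2 ⟨(v, w), hw, rfl⟩)
      have h2 := dist_algFees_le (b := b) (zero_le_one.trans hτ) hP hς hwP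
      have h3 : c v w = G.cost v w := by simp [hc, algFees, hw]
      have h4 := G.cost_nonneg v w hE
      unfold perceived at h1 ⊢
      rw [h3]
      have h5 : β v * (G.cost v w / b + G.dist G.cost w) ≤ β v * (α / b) := by
        apply mul_le_mul_of_nonneg_left _ (hβ0 v).le
        rw [le_div_iff₀ hb]
        field_simp
        linarith
      have h6 : G.cost v w ≤ β v * (G.cost v w / b) := by
        rw [mul_div_assoc', le_div_iff₀ hb, mul_comm]
        exact mul_le_mul_of_nonneg_right (hβ v).1 h4
      have h7 : r = (1 + τ) * (α / b) := by rw [hr]; ring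
      have h8 := mul_le_mul_of_nonneg_left h2 (hβ0 v).le
      rw [h7]
      have h9 := mul_le_mul_of_nonneg_left h5 (by linarith : 0 ≤ 1 + τ)
      nlinarith [mul_nonneg (by linarith : 0 ≤ τ) h4, mul_le_mul_of_nonneg_left h6
        (by linarith : 0 ≤ 1 + τ)]
    · have h1 := hI 0 (by simpa using hv)
      simp only [Function.iterate_zero, id_eq, zero_add, Function.iterate_one] at h1
      have hE := (hς v hvt).1
      refine (G.minPerceived_le c (β v) hE).trans ?_
      have h2 : c v (ς v) = G.cost v (ς v) := by
        simp only [hc]; rw [algFees_succ_of_notMem hv, add_zero]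
      have h3 : 0 ≤ r - G.dist c v :=
        nonneg_of_mul_nonneg_right ((G.cost_nonneg _ _ hE).trans h1) hb
      obtain ⟨w, hw, he⟩ := hd.exists_eq v hvt
      have hwς : w = ς v := by
        by_contra hne
        have h4 := hbig v w hw (fun h => hv (hP.of_mem_pathEdges h).1) hne
        linarith [hd0 w]
      subst hwς
      unfold perceived
      rw [h2]
      have h5 := mul_le_mul_of_nonneg_right (hβ v).1 h3
      have h6 : G.dist c (ς v) ≤ G.dist c v := by linarith [hc0 _ _ hw]
      have h7 := mul_le_mul_of_nonneg_left h6 (hβ0 v).le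
      linarith
  have hI : ∀ v, Relation.ReflTransGen (G.Step c β r) G.s v → I v := by
    intro v hsv
    induction hsv with
    | refl => exact .inl hP.start_mem
    | @tail v w hsv hvw hIv =>
      obtain ⟨hvt, hle, hE, he⟩ := hvw
      rw [← he] at hle
      by_cases hwP : w ∈ P
      · exact .inl hwP
      have hnot : (v, w) ∉ pathEdges P := fun h => hwP (hP.of_mem_pathEdges h).2.1
      have hwς := hsucc v w hE hle hnot
      subst hwς
      refine .inr ⟨hwP, fun j hj => ?_⟩
      rcases hIv with hv | ⟨hv, hI⟩
      · obtain ⟨hpos, hmem, -⟩ := hς.detour_spec hP.t_mem hvt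
        set k₀ := sInf {k : ℕ | 0 < k ∧ ς^[k] v ∈ P} with hk₀
        have hjk : j + 1 < k₀ := by
          by_contra hcon
          obtain ⟨i, hi⟩ : ∃ i, k₀ = i + 1 := ⟨k₀ - 1, by omega⟩
          refine hj i (by omega) ?_
          rwa [hi] at hmem
        have h1 : G.cost (ς^[j] (ς v)) (ς^[j + 1] (ς v)) ≤ G.detourMax P ς v :=
          le_maxOf (List.mem_map.2 ⟨j + 1, List.mem_range.2 hjk, rfl⟩)
        have h2 : c v (ς v) = G.cost v (ς v) + τ * G.detourMax P ς v := by
          simp [hc, algFees, hnot, hv, hwP]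
        have h3 := G.cost_nonneg v _ hE
        unfold perceived at hle
        rw [h2] at hle
        have h4 : τ * G.detourMax P ς v ≤ β v * (r - G.dist c (ς v)) := by linarith
        have hM := detourMax_nonneg (G := G) P ς v
        have h5 : 0 ≤ r - G.dist c (ς v) :=
          nonneg_of_mul_nonneg_right ((mul_nonneg (by linarith) hM).trans h4) (hβ0 v)
        have h6 := mul_le_mul_of_nonneg_right (hβ v).2.1 h5
        have h7 : τ * G.detourMax P ς v ≤ τ * (b * (r - G.dist c (ς v))) := by linarith
        exact h1.trans (le_of_mul_le_mul_left h7 (by linarith))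
      · have h1 := hI (j + 1) (fun i hi => by
          cases i with
          | zero => exact hv
          | succ i => exact hj i (by omega))
        have h2 := hd.le v _ hE
        obtain ⟨w, hw, he'⟩ := hd.exists_eq v hvt
        have h0 := hI 0 (by simpa using hv)
        simp only [Function.iterate_zero, id_eq, zero_add, Function.iterate_one] at h0
        have h3 : 0 ≤ r - G.dist c v :=
          nonneg_of_mul_nonneg_right ((G.cost_nonneg _ _ hE).trans h0) hb
        have hwς : w = ς v := by
          by_contra hne
          have h4 := hbig v w hw (fun h => hv (hP.of_mem_pathEdges h).1) hne
          linarith [hd0 w]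
        subst hwς
        have h6 : G.dist c (ς v) ≤ G.dist c v := by linarith [hc0 _ _ hw]
        refine h1.trans ?_
        exact mul_le_mul_of_nonneg_left (by linarith) hb.le
  exact fun v hsv hvt => hquit v (hI v hsv) hvt

/-! ### Extra costs matter only on edges -/

theorem dist_congr [Finite V] {c c' : V → V → ℝ} (h : ∀ v w, G.E v w → c v w = c' v w) :
    G.dist c = G.dist c' :=
  funext fun v => le_antisymm (G.dist_mono (fun v w hE => (h v w hE).le) v)
    (G.dist_mono (fun v w hE => (h v w hE).ge) v)

theorem motivating_congr [Finite V] {c c' : V → V → ℝ} (h : ∀ v w, G.E v w → c v w = c' v w)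
    {β : V → ℝ} {r : ℝ} (hm : G.Motivating c β r) : G.Motivating c' β r := by
  have h1 : ∀ x v w, G.E v w → G.perceived c x v w = G.perceived c' x v w := by
    intro x v w hE
    simp only [perceived, h v w hE, dist_congr h]
  have h2 : ∀ x v, G.minPerceived c x v = G.minPerceived c' x v := by
    intro x v
    unfold minPerceived
    congr 1
    ext y
    exact exists_congr fun w => and_congr_right fun hE => by rw [h1 x v w hE]
  have h3 : G.Step c β r = G.Step c' β r := by
    funext v w
    simp only [Step, h2]
    refine propext (and_congr_right fun _ => and_congr_right fun _ => and_congr_right fun hE => ?_)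
    rw [h1 _ v w hE]
  intro v hv hvt
  rw [← h3] at hv
  rw [← h2]
  exact hm v hv hvt

end TaskGraph

/-! ### Present bias sets -/

theorem IsBiasSet.spec {B : Set ℝ} (hB : IsBiasSet B) :
    sInf B ∈ B ∧ 0 < sInf B ∧ 1 ≤ range B ∧ ∀ x ∈ B, sInf B ≤ x ∧ x ≤ range B * sInf B ∧ x ≤ 1 := by
  obtain ⟨L, ⟨hne, hL⟩, rfl⟩ := hB
  have hcomp : IsCompact (unionOf L) := by
    have : unionOf L = ⋃ J ∈ {J | J ∈ L}, Set.Icc J.1 J.2 := by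
      ext x; simp only [unionOf, Set.mem_ofPred_eq, Set.mem_iUnion, exists_prop]
    rw [this]
    exact (List.finite_toSet L).isCompact_biUnion fun J _ => isCompact_Icc
  have hnonempty : (unionOf L).Nonempty := by
    obtain ⟨J, hJ⟩ := List.exists_mem_of_ne_nil L hne
    exact ⟨J.1, J, hJ, le_rfl, (hL J hJ).2.1⟩
  have hmem := hcomp.sInf_mem hnonempty
  have hpos : ∀ x ∈ unionOf L, 0 < x ∧ x ≤ 1 := by
    rintro x ⟨J, hJ, hx1, hx2⟩
    exact ⟨(hL J hJ).1.trans_le hx1, hx2.trans (hL J hJ).2.2⟩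
  have hle : ∀ x ∈ unionOf L, sInf (unionOf L) ≤ x ∧ x ≤ sSup (unionOf L) := fun x hx =>
    ⟨csInf_le hcomp.bddBelow hx, le_csSup hcomp.bddAbove hx⟩
  have h0 := (hpos _ hmem).1
  refine ⟨hmem, h0, ?_, fun x hx => ⟨(hle x hx).1, ?_, (hpos x hx).2⟩⟩
  · rw [range, le_div_iff₀ h0, one_mul]
    exact (hle _ hmem).2
  · rw [range, div_mul_cancel₀ _ h0.ne']
    exact (hle x hx).2

/-- The approximation guarantee, for arbitrary choices made by the algorithm. -/
theorem TaskGraph.algFees_spec {V : Type*} [Finite V] (G : TaskGraph V) {B : Set ℝ}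
    (hB : IsBiasSet B) {P : List V} {ς : V → V} (hP : G.IsMinmaxPath (sInf B) P)
    (hς : G.IsCheapestSucc ς) :
    G.IsCostConfig (G.algFees (sInf B) (range B) P ς) ∧
      G.MotivatesAll B (G.algFees (sInf B) (range B) P ς)
        ((1 + range B) * G.bottleneck (sInf B) P / sInf B) ∧
      G.bottleneck (sInf B) P / sInf B ≤ G.optReward B ∧
      G.optReward B ≤ (1 + range B) * G.bottleneck (sInf B) P / sInf B := by
  obtain ⟨hmem, hb, hτ, hx⟩ := hB.spec
  have hconf : G.IsCostConfig (G.algFees (sInf B) (range B) P ς) := fun v w _ =>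
    algFees_nonneg hb (by linarith) P ς v w
  have hmot : G.MotivatesAll B (G.algFees (sInf B) (range B) P ς)
      ((1 + range B) * G.bottleneck (sInf B) P / sInf B) := fun β hβ =>
    motivating_algFees hb hτ hP.1 hς fun v => hx _ (hβ v)
  have hα := bottleneck_nonneg (G := G) (sInf B) P
  have hr : 0 ≤ (1 + range B) * G.bottleneck (sInf B) P / sInf B := by positivity
  refine ⟨hconf, hmot, ?_, csInf_le ⟨0, fun r hr => hr.1⟩ ⟨hr, _, hconf, hmot⟩⟩
  refine le_csInf ⟨_, hr, _, hconf, hmot⟩ ?_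
  rintro r ⟨hr0, f, hf, hm⟩
  obtain ⟨Q, hQ, hle⟩ := G.exists_bottleneck_le hf hb.le hr0 (hm _ fun _ => hmem)
  rw [div_le_iff₀ hb, mul_comm]
  exact (hP.2 Q hQ).trans hle

/-! ### Bit lengths of the numbers in a computation -/

/-- Size limits for a computation: `N` is a common denominator and `X` bounds both its bit length
and the number of iterations of every loop. -/
structure Limits where
  N : ℕ
  X : ℕ
  N_pos : 0 < N
  N_le : N ≤ 2 ^ X

namespace Limits

variable (l : Limits)

/-- `l.Small k q`: the number `q` is an integer multiple of `1 / N ^ k`, and its absolute value is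
at most `2 ^ (k * (X + 1))`.  Such numbers have `O(k * X)` bits, and arithmetic operations add up
their levels `k`. -/
def Small (k : ℕ) (q : ℚ) : Prop :=
  (∃ z : ℤ, q * (l.N : ℚ) ^ k = z) ∧ |q| ≤ 2 ^ (k * (l.X + 1))

variable {l}

theorem Small.mono {k m : ℕ} {q : ℚ} (h : l.Small k q) (hkm : k ≤ m) : l.Small m q := by
  obtain ⟨⟨z, hz⟩, hq⟩ := h
  refine ⟨⟨z * (l.N : ℤ) ^ (m - k), ?_⟩, hq.trans ?_⟩
  · push_cast
    rw [← hz, mul_assoc, ← pow_add, Nat.add_sub_cancel' hkm]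
  · exact pow_le_pow_right₀ (by norm_num) (Nat.mul_le_mul_right _ hkm)

theorem small_natCast {k m : ℕ} (h : m ≤ 2 ^ (k * (l.X + 1))) : l.Small k (m : ℚ) := by
  refine ⟨⟨m * (l.N : ℤ) ^ k, by push_cast; rfl⟩, ?_⟩
  rw [abs_of_nonneg (by positivity)]
  exact_mod_cast h

theorem small_natCast_of_le {m : ℕ} (h : m ≤ l.X) : l.Small 1 (m : ℚ) := by
  apply small_natCast
  have h1 : l.X < 2 ^ l.X := Nat.lt_two_pow_self
  have h2 : 2 ^ l.X ≤ 2 ^ (1 * (l.X + 1)) := Nat.pow_le_pow_right (by norm_num) (by omega)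
  omega

theorem small_zero (k : ℕ) : l.Small k 0 := by
  simpa using small_natCast (l := l) (k := k) (m := 0) (by positivity)

theorem small_one (k : ℕ) : l.Small k 1 := by
  simpa using small_natCast (l := l) (k := k) (m := 1) Nat.one_le_two_pow

theorem Small.add {k m : ℕ} {q r : ℚ} (hq : l.Small k q) (hr : l.Small m r) :
    l.Small (k + m + 1) (q + r) := by
  obtain ⟨⟨z, hz⟩, h1⟩ := hq.mono (Nat.le_add_right k m)
  obtain ⟨⟨y, hy⟩, h2⟩ := hr.mono (Nat.le_add_left m k)
  refine ⟨⟨(z + y) * l.N, ?_⟩, ?_⟩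
  · push_cast
    rw [← hz, ← hy]; ring
  · calc |q + r| ≤ |q| + |r| := abs_add_le _ _
      _ ≤ 2 * 2 ^ ((k + m) * (l.X + 1)) := by linarith
      _ = 2 ^ ((k + m) * (l.X + 1) + 1) := by rw [pow_succ]; ring
      _ ≤ 2 ^ ((k + m + 1) * (l.X + 1)) := by
        apply pow_le_pow_right₀ (by norm_num)
        rw [add_one_mul (k + m)]; omega

theorem Small.neg {k : ℕ} {q : ℚ} (hq : l.Small k q) : l.Small k (-q) := by
  obtain ⟨⟨z, hz⟩, h⟩ := hq
  exact ⟨⟨-z, by push_cast; rw [← hz]; ring⟩, by rwa [abs_neg]⟩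

theorem Small.mul {k m : ℕ} {q r : ℚ} (hq : l.Small k q) (hr : l.Small m r) :
    l.Small (k + m) (q * r) := by
  obtain ⟨⟨z, hz⟩, h1⟩ := hq
  obtain ⟨⟨y, hy⟩, h2⟩ := hr
  refine ⟨⟨z * y, ?_⟩, ?_⟩
  · push_cast
    rw [← hz, ← hy]; ring
  · rw [abs_mul, add_mul, pow_add]
    exact mul_le_mul h1 h2 (abs_nonneg _) (by positivity)

theorem Small.bits_le {k : ℕ} {q : ℚ} (h : l.Small k q) :
    bits q ≤ (k + 1) * (3 * l.X + 3) := by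
  obtain ⟨⟨z, hz⟩, hq⟩ := h
  have hNk : (0 : ℚ) < (l.N : ℚ) ^ k := by have := l.N_pos; positivity
  have hden : q.den ∣ l.N ^ k := by
    have h1 : q = Rat.divInt z ((l.N ^ k : ℕ) : ℤ) := by
      rw [Rat.divInt_eq_div, eq_div_iff (by push_cast; exact hNk.ne')]
      push_cast; exact hz
    have h2 := Rat.den_dvd z ((l.N ^ k : ℕ) : ℤ)
    rw [← h1] at h2
    exact_mod_cast h2
  have hden' : q.den ≤ 2 ^ (l.X * k) := by
    calc q.den ≤ l.N ^ k := Nat.le_of_dvd (pow_pos l.N_pos k) hden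
      _ ≤ (2 ^ l.X) ^ k := Nat.pow_le_pow_left l.N_le k
      _ = 2 ^ (l.X * k) := (pow_mul _ _ _).symm
  have hnum : q.num.natAbs ≤ 2 ^ (k * (l.X + 1) + l.X * k) := by
    have h1 : (q.num.natAbs : ℚ) = |q| * q.den := by
      rw [Nat.cast_natAbs, Int.cast_abs]
      nth_rewrite 1 [← Rat.mul_den_eq_num q]
      rw [abs_mul, Nat.abs_cast]
    have h2 : (q.num.natAbs : ℚ) ≤ 2 ^ (k * (l.X + 1) + l.X * k) := by
      rw [h1, pow_add]
      exact mul_le_mul hq (by exact_mod_cast hden') (by positivity) (by positivity)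
    exact_mod_cast h2
  have hs1 : Nat.size q.den ≤ l.X * k + 1 :=
    Nat.size_le.2 (hden'.trans_lt (Nat.pow_lt_pow_right (by norm_num) (by omega)))
  have hs2 : Nat.size q.num.natAbs ≤ k * (l.X + 1) + l.X * k + 1 :=
    Nat.size_le.2 (hnum.trans_lt (Nat.pow_lt_pow_right (by norm_num) (by omega)))
  unfold bits
  nlinarith

end Limits

/-- The level (in the sense of `Limits.Small`) up to which memory cells are filled; the numbers
stored by the algorithm below stay under level 10. -/
def cellLevel : ℕ := 12

/-- All memory cells hold numbers of bounded size. -/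
def Limits.Good (l : Limits) (σ : Mem) : Prop := ∀ a i, l.Small cellLevel (σ a i)

theorem Mem.store_same (σ : Mem) (a i : ℕ) (q : ℚ) :
    σ.store a i q a = Function.update (σ a) i q := by simp [Mem.store]

theorem Mem.store_ne (σ : Mem) {a a' : ℕ} (h : a' ≠ a) (i : ℕ) (q : ℚ) :
    σ.store a i q a' = σ a' := by simp [Mem.store, h]

theorem Limits.Good.store {l : Limits} {σ : Mem} (h : l.Good σ) {a i : ℕ} {q : ℚ}
    (hq : l.Small cellLevel q) : l.Good (σ.store a i q) := by
  intro a' i'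
  by_cases ha : a' = a
  · subst ha
    rw [Mem.store_same]
    by_cases hi : i' = i
    · subst hi; simpa using hq
    · rw [Function.update_of_ne hi]; exact h _ _
  · rw [Mem.store_ne _ ha]; exact h _ _

namespace Term

/-- A bound for the level of the value of an expression. -/
def level : Term → ℕ
  | const q => q.num.natAbs
  | read _ _ => cellLevel
  | add x y => x.level + y.level + 1
  | sub x y => x.level + y.level + 1
  | mul x y => x.level + y.level
  | div _ _ => cellLevel
  | le _ _ => 0

/-- A bound, up to the factor `3 * X + 3`, for the cost of evaluating an expression. -/
def time : Term → ℕ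
  | const q => (const q).level + 1
  | read a i => i.time + (read a i).level + 1
  | add x y => x.time + y.time + (add x y).level + 1
  | sub x y => x.time + y.time + (sub x y).level + 1
  | mul x y => x.time + y.time + (mul x y).level + 1
  | div x y => x.time + y.time + (div x y).level + 1
  | le x y => x.time + y.time + (le x y).level + 1

/-- A condition under which the value of an expression has bounded size: all constants are
integers, and all quotients have bounded size. -/
def Fine (l : Limits) (σ : Mem) : Term → Prop
  | const q => q.den = 1
  | read _ i => i.Fine l σ
  | add x y => x.Fine l σ ∧ y.Fine l σ
  | sub x y => x.Fine l σ ∧ y.Fine l σ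
  | mul x y => x.Fine l σ ∧ y.Fine l σ
  | div x y => x.Fine l σ ∧ y.Fine l σ ∧ l.Small cellLevel (x.eval σ / y.eval σ)
  | le x y => x.Fine l σ ∧ y.Fine l σ

theorem Fine.small {l : Limits} {σ : Mem} (hσ : l.Good σ) {x : Term} (hx : x.Fine l σ) :
    l.Small x.level (x.eval σ) := by
  induction x with
  | const q =>
    have h1 : q = (q.num : ℚ) := by
      have := Rat.num_div_den q
      rw [show q.den = 1 from hx] at this
      simpa using this.symm
    refine ⟨⟨q.num * (l.N : ℤ) ^ (const q).level, ?_⟩, ?_⟩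
    · push_cast; rw [← h1]; rfl
    · have h2 : |q| = (q.num.natAbs : ℚ) := by
        rw [Nat.cast_natAbs, Int.cast_abs, ← h1]
      simp only [eval, level, h2]
      have h3 : q.num.natAbs ≤ 2 ^ (q.num.natAbs * (l.X + 1)) :=
        Nat.lt_two_pow_self.le.trans (Nat.pow_le_pow_right (by norm_num)
          (Nat.le_mul_of_pos_right _ (Nat.succ_pos _)))
      exact_mod_cast h3
  | read a i _ => exact hσ _ _
  | add x y ihx ihy => exact (ihx hx.1).add (ihy hx.2)
  | sub x y ihx ihy =>
    simp only [eval, sub_eq_add_neg]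
    exact (ihx hx.1).add (ihy hx.2).neg
  | mul x y ihx ihy => exact (ihx hx.1).mul (ihy hx.2)
  | div x y _ _ => exact hx.2.2
  | le x y _ _ =>
    simp only [eval]
    split_ifs
    · exact Limits.small_one _
    · exact Limits.small_zero _

theorem Fine.cost_le {l : Limits} {σ : Mem} (hσ : l.Good σ) {x : Term} (hx : x.Fine l σ) :
    x.cost σ ≤ x.time * (3 * l.X + 3) := by
  have hb := (hx.small hσ).bits_le
  induction x with
  | const q => exact hb
  | read a i ih =>
    have h1 := ih hx (hx.small (x := i) hσ).bits_le
    simp only [cost, time]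
    linarith
  | add x y ihx ihy =>
    have h1 := ihx hx.1 (hx.1.small hσ).bits_le
    have h2 := ihy hx.2 (hx.2.small hσ).bits_le
    simp only [cost, time]
    linarith
  | sub x y ihx ihy =>
    have h1 := ihx hx.1 (hx.1.small hσ).bits_le
    have h2 := ihy hx.2 (hx.2.small hσ).bits_le
    simp only [cost, time]
    linarith
  | mul x y ihx ihy =>
    have h1 := ihx hx.1 (hx.1.small hσ).bits_le
    have h2 := ihy hx.2 (hx.2.small hσ).bits_le
    simp only [cost, time]
    linarith
  | div x y ihx ihy =>
    have h1 := ihx hx.1 (hx.1.small hσ).bits_le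
    have h2 := ihy hx.2.1 (hx.2.1.small hσ).bits_le
    simp only [cost, time]
    linarith
  | le x y ihx ihy =>
    have h1 := ihx hx.1 (hx.1.small hσ).bits_le
    have h2 := ihy hx.2 (hx.2.small hσ).bits_le
    simp only [cost, time]
    linarith

end Term

/-! ### Reasoning about programs -/

namespace Prog

/-- The arrays that a program may write to. -/
def writes : Prog → List ℕ
  | skip => []
  | write a _ _ => [a]
  | seq p q => p.writes ++ q.writes
  | ite _ p q => p.writes ++ q.writes
  | .while _ p => p.writes

open Polynomial in
/-- A bound, up to the factor `3 * X + 3`, for the running time of a program all of whose loops are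
iterated at most `X` times, as a polynomial in `X`. -/
noncomputable def time : Prog → ℕ[X]
  | skip => 1
  | write _ i x => C (i.time + x.time + 1)
  | seq p q => p.time + q.time
  | ite x p q => C x.time + p.time + q.time
  | .while x p => (X + 1) * (C x.time + p.time)

/-- A program leaves all arrays unchanged that it does not mention as targets. -/
theorem exec_frame {p : Prog} {σ σ' : Mem} {k : ℕ} (h : Exec p σ σ' k) :
    ∀ a ∉ p.writes, σ' a = σ a := by
  induction h with
  | skip => exact fun _ _ => rfl
  | write a i x σ =>
    intro a' ha'
    exact Mem.store_ne _ (by simpa [writes] using ha') _ _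
  | seq _ _ ih1 ih2 =>
    intro a ha
    simp only [writes, List.mem_append, not_or] at ha
    rw [ih2 a ha.2, ih1 a ha.1]
  | ite_true _ _ ih =>
    intro a ha
    simp only [writes, List.mem_append, not_or] at ha
    exact ih a ha.1
  | ite_false _ _ ih =>
    intro a ha
    simp only [writes, List.mem_append, not_or] at ha
    exact ih a ha.2
  | while_true _ _ _ ih1 ih2 =>
    intro a ha
    rw [ih2 a ha, ih1 a ha]
  | while_false => exact fun _ _ => rfl

/-- `p` terminates when it is started in `σ`, within its time bound and without creating large
numbers, and the final memory satisfies `Q`. -/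
def Reaches (l : Limits) (p : Prog) (σ : Mem) (Q : Mem → Prop) : Prop :=
  ∃ σ' k, Exec p σ σ' k ∧ k ≤ p.time.eval l.X * (3 * l.X + 3) ∧ l.Good σ' ∧ Q σ'

variable {l : Limits} {σ : Mem} {Q : Mem → Prop}

theorem Reaches.mono {p : Prog} {R : Mem → Prop} (h : Reaches l p σ Q)
    (hQR : ∀ σ', l.Good σ' → (∀ a ∉ p.writes, σ' a = σ a) → Q σ' → R σ') : Reaches l p σ R := by
  obtain ⟨σ', k, h1, h2, h3, h4⟩ := h
  exact ⟨σ', k, h1, h2, h3, hQR σ' h3 (exec_frame h1) h4⟩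

theorem reaches_skip (hσ : l.Good σ) (hQ : Q σ) : Reaches l skip σ Q :=
  ⟨σ, 1, .skip σ, by simp [time], hσ, hQ⟩

theorem reaches_write {a : ℕ} {i x : Term} (hσ : l.Good σ) (hi : i.Fine l σ) (hx : x.Fine l σ)
    (hs : l.Small cellLevel (x.eval σ)) (hQ : Q (σ.store a ⌊i.eval σ⌋₊ (x.eval σ))) :
    Reaches l (write a i x) σ Q := by
  refine ⟨_, _, .write a i x σ, ?_, hσ.store hs, hQ⟩
  have h1 := hi.cost_le hσ
  have h2 := hx.cost_le hσ
  simp only [time, Polynomial.eval_C]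
  linarith

theorem reaches_seq {p q : Prog} {R : Mem → Prop} (hp : Reaches l p σ R)
    (hq : ∀ σ', l.Good σ' → (∀ a ∉ p.writes, σ' a = σ a) → R σ' → Reaches l q σ' Q) :
    Reaches l (seq p q) σ Q := by
  obtain ⟨σ', k, h1, h2, h3, h4⟩ := hp
  obtain ⟨σ'', k', h1', h2', h3', h4'⟩ := hq σ' h3 (exec_frame h1) h4
  refine ⟨σ'', _, .seq h1 h1', ?_, h3', h4'⟩
  simp only [time, Polynomial.eval_add]
  linarith

theorem reaches_ite {x : Term} {p q : Prog} (hσ : l.Good σ) (hx : x.Fine l σ)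
    (hp : x.eval σ ≠ 0 → Reaches l p σ Q) (hq : x.eval σ = 0 → Reaches l q σ Q) :
    Reaches l (ite x p q) σ Q := by
  have h0 := hx.cost_le hσ
  by_cases h : x.eval σ = 0
  · obtain ⟨σ', k, h1, h2, h3, h4⟩ := hq h
    refine ⟨σ', _, .ite_false h h1, ?_, h3, h4⟩
    simp only [time, Polynomial.eval_add, Polynomial.eval_C]
    linarith [Nat.zero_le (p.time.eval l.X * (3 * l.X + 3))]
  · obtain ⟨σ', k, h1, h2, h3, h4⟩ := hp h
    refine ⟨σ', _, .ite_true h h1, ?_, h3, h4⟩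
    simp only [time, Polynomial.eval_add, Polynomial.eval_C]
    linarith [Nat.zero_le (q.time.eval l.X * (3 * l.X + 3))]

/-- `for c = 0, …, bound - 1 do body`; the counter is cell `0` of array `c`. -/
def loop (c : ℕ) (bound : Term) (body : Prog) : Prog :=
  seq (write c (.const 0) (.const 0))
    (.while (.le (.add (.read c (.const 0)) (.const 1)) bound)
      (seq body (write c (.const 0) (.add (.read c (.const 0)) (.const 1)))))

/-- A loop that is iterated `m ≤ X` times establishes its invariant for `m`. -/
theorem reaches_loop {c : ℕ} {bound : Term} {body : Prog} {m : ℕ} (Inv : ℕ → Mem → Prop)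
    (hσ : l.Good σ) (hm : m ≤ l.X) (hc : c ∉ body.writes) (hfine : ∀ σ, bound.Fine l σ)
    (hbound : ∀ σ', (∀ a ∉ c :: body.writes, σ' a = σ a) → bound.eval σ' = m)
    (hInv : ∀ i σ' q, Inv i σ' → Inv i (σ'.store c 0 q)) (h0 : Inv 0 σ)
    (hstep : ∀ i < m, ∀ σ', l.Good σ' → (∀ a ∉ c :: body.writes, σ' a = σ a) → σ' c 0 = i →
      Inv i σ' → Reaches l body σ' (Inv (i + 1))) :
    Reaches l (loop c bound body) σ (Inv m) := by
  set test : Term := .le (.add (.read c (.const 0)) (.const 1)) bound with htest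
  set incr := write c (.const 0) (.add (.read c (.const 0)) (.const 1)) with hincr
  set T := (test.time + (seq body incr).time.eval l.X) * (3 * l.X + 3) with hT
  have htf : ∀ σ, test.Fine l σ := fun σ => by
    simp only [htest, Term.Fine]
    exact ⟨by simp, hfine σ⟩
  -- `j` is the number of iterations that are left
  have key : ∀ j i, i + j = m → ∀ σ', l.Good σ' → (∀ a ∉ c :: body.writes, σ' a = σ a) →
      σ' c 0 = i → Inv i σ' → ∃ σ'' k, Exec (.while test (seq body incr)) σ' σ'' k ∧
        k ≤ (j + 1) * T ∧ l.Good σ'' ∧ Inv m σ'' := by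
    intro j
    induction j with
    | zero =>
      intro i hij σ' hG hfr hci hI
      have hb := hbound σ' hfr
      have h0 : test.eval σ' = 0 := by
        simp only [htest, Term.eval, hb, Nat.floor_zero, hci]
        rw [if_neg]
        have : (i : ℚ) = m := by exact_mod_cast (by omega : i = m)
        rw [this]; linarith
      refine ⟨σ', _, .while_false h0, ?_, hG, by rwa [← hij]⟩
      have h1 := (htf σ').cost_le hG
      rw [hT]
      linarith [Nat.zero_le ((seq body incr).time.eval l.X * (3 * l.X + 3))]
    | succ j ih =>
      intro i hij σ' hG hfr hci hI
      have hb := hbound σ' hfr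
      have h0 : test.eval σ' ≠ 0 := by
        simp only [htest, Term.eval, hb, Nat.floor_zero, hci]
        rw [if_pos]
        · norm_num
        · exact_mod_cast (by omega : i + 1 ≤ m)
      have hbody : Reaches l (seq body incr) σ' (fun σ'' => σ'' c 0 = (i + 1 : ℕ) ∧
          Inv (i + 1) σ'') := by
        apply reaches_seq (hstep i (by omega) σ' hG hfr hci hI)
        intro σ₁ hG₁ hfr₁ hI₁
        have hc1 : σ₁ c 0 = i := by rw [hfr₁ c hc, hci]
        have hev : (Term.add (.read c (.const 0)) (.const 1)).eval σ₁ = ((i + 1 : ℕ) : ℚ) := by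
          simp [Term.eval, hc1]
        apply reaches_write hG₁ (by simp [Term.Fine]) (by simp [Term.Fine])
        · rw [hev]
          exact (Limits.small_natCast_of_le (by omega)).mono (by decide)
        · refine ⟨?_, hInv _ _ _ (by simpa [Term.eval] using hI₁)⟩
          rw [Mem.store_same, hev]
          simp [Term.eval]
      obtain ⟨σ₂, k₂, he, hk, hG₂, hc₂, hI₂⟩ := hbody
      have hfr₂ : ∀ a ∉ c :: body.writes, σ₂ a = σ a := by
        intro a ha
        rw [exec_frame he a, hfr a ha]
        simpa [writes, hincr, and_comm] using ha
      obtain ⟨σ₃, k₃, he', hk', hG₃, hI₃⟩ := ih (i + 1) (by omega) σ₂ hG₂ hfr₂ hc₂ hI₂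
      refine ⟨σ₃, _, .while_true h0 he he', ?_, hG₃, hI₃⟩
      have h1 := (htf σ').cost_le hG
      have h2 : test.cost σ' + k₂ ≤ T := by rw [hT, add_mul]; exact add_le_add h1 hk
      linarith
  have hset : Reaches l (write c (.const 0) (.const 0)) σ (fun σ' => σ' c 0 = (0 : ℕ) ∧
      Inv 0 σ') := by
    apply reaches_write hσ (by simp [Term.Fine]) (by simp [Term.Fine])
    · exact Limits.small_zero _
    · refine ⟨by simp [Term.eval, Mem.store_same], ?_⟩
      simpa [Term.eval] using hInv 0 σ 0 h0
  obtain ⟨σ₁, k₁, he, hk, hG₁, hc₁, hI₁⟩ := hset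
  have hfr₁ : ∀ a ∉ c :: body.writes, σ₁ a = σ a := by
    intro a ha
    apply exec_frame he a
    simp only [List.mem_cons, not_or] at ha
    simpa [writes] using ha.1
  obtain ⟨σ₂, k₂, he', hk', hG₂, hI₂⟩ := key m 0 (by simp) σ₁ hG₁ hfr₁ hc₁ hI₁
  refine ⟨σ₂, _, .seq he he', ?_, hG₂, hI₂⟩
  have h3 : (m + 1) * T ≤ (l.X + 1) * T := Nat.mul_le_mul_right _ (by omega)
  have h4 : (loop c bound body).time.eval l.X * (3 * l.X + 3) =
      (write c (.const 0) (.const 0)).time.eval l.X * (3 * l.X + 3) + (l.X + 1) * T := by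
    simp only [loop, hT, htest, hincr, time, Polynomial.eval_add, Polynomial.eval_mul,
      Polynomial.eval_C, Polynomial.eval_X, Polynomial.eval_one]
    ring
  rw [h4]
  exact add_le_add hk (hk'.trans h3)

end Prog

/-! ### The input of the machine -/

theorem one_le_bits (q : ℚ) : 1 ≤ bits q := by
  have : 0 < Nat.size q.den := Nat.size_pos.2 q.den_pos
  unfold bits; omega

theorem length_le_sum_bits (l : List ℚ) : l.length ≤ (l.map bits).sum := by
  induction l with
  | nil => simp
  | cons q l ih =>
    have := one_le_bits q
    simp only [List.length_cons, List.map_cons, List.sum_cons]; omega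

theorem inputSize_eq (L : List (List ℚ)) : inputSize L = (L.flatten.map bits).sum := by
  induction L with
  | nil => rfl
  | cons l L ih => simp_all [inputSize]

theorem length_le_inputSize {L : List (List ℚ)} {l : List ℚ} (h : l ∈ L) :
    l.length ≤ inputSize L :=
  (length_le_sum_bits l).trans
    (List.single_le_sum (by simp) _ (List.mem_map.2 ⟨l, h, rfl⟩))

/-- The size limits for a given input.  The common denominator is a multiple of all nonzero
numerators, too, so that it is also one for the inverses of the numbers in the input. -/
def inputLimits (L : List (List ℚ)) : Limits where
  N := (L.flatten.map fun q => q.den * max 1 q.num.natAbs).prod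
  X := inputSize L
  N_pos := by
    refine Nat.pos_of_ne_zero fun h => ?_
    rw [List.prod_eq_zero_iff, List.mem_map] at h
    obtain ⟨q, -, hq⟩ := h
    have := q.den_pos
    have : 0 < q.den * max 1 q.num.natAbs := by positivity
    omega
  N_le := by
    rw [inputSize_eq]
    induction L.flatten with
    | nil => simp
    | cons q l ih =>
      simp only [List.map_cons, List.prod_cons, List.sum_cons, pow_add]
      refine Nat.mul_le_mul ?_ ih
      rw [bits, add_comm, pow_add]
      exact Nat.mul_le_mul (Nat.lt_size_self _).le
        (max_le Nat.one_le_two_pow (Nat.lt_size_self _).le)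

section
variable {L : List (List ℚ)} {q : ℚ}

theorem dvd_inputLimits (hq : q ∈ L.flatten) :
    q.den * max 1 q.num.natAbs ∣ (inputLimits L).N :=
  List.dvd_prod (List.mem_map.2 ⟨q, hq, rfl⟩)

theorem two_pow_bits_le (hq : q ∈ L.flatten) :
    (2 : ℚ) ^ bits q ≤ 2 ^ (1 * ((inputLimits L).X + 1)) := by
  apply pow_le_pow_right₀ (by norm_num)
  have h1 : bits q ≤ (L.flatten.map bits).sum :=
    List.single_le_sum (by simp) _ (List.mem_map.2 ⟨q, hq, rfl⟩)
  have h2 : (inputLimits L).X = (L.flatten.map bits).sum := inputSize_eq L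
  omega

theorem small_of_mem (hq : q ∈ L.flatten) : (inputLimits L).Small 1 q := by
  constructor
  · obtain ⟨m, hm⟩ := (Dvd.intro _ rfl).trans (dvd_inputLimits hq)
    refine ⟨q.num * m, ?_⟩
    rw [hm]
    push_cast
    rw [pow_one, ← mul_assoc, Rat.mul_den_eq_num]
  · refine le_trans ?_ (two_pow_bits_le hq)
    have h1 : |q| ≤ (q.num.natAbs : ℚ) := by
      rw [Nat.cast_natAbs, Int.cast_abs]
      rw [← Rat.mul_den_eq_num q, abs_mul, Nat.abs_cast]
      exact le_mul_of_one_le_right (abs_nonneg _) (by exact_mod_cast q.den_pos)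
    refine h1.trans ?_
    have h2 : q.num.natAbs ≤ 2 ^ bits q :=
      (Nat.lt_size_self _).le.trans (Nat.pow_le_pow_right (by norm_num) (Nat.le_add_right _ _))
    exact_mod_cast h2

theorem small_inv_of_mem (hq : q ∈ L.flatten) (h0 : 0 < q) :
    (inputLimits L).Small 1 (1 / q) := by
  have hnum : 0 < q.num := Rat.num_pos.2 h0
  have hnat : ((q.num.natAbs : ℕ) : ℚ) = q.num := by
    rw [Nat.cast_natAbs, abs_of_pos hnum]
  have hinv : 1 / q = q.den / q.num := by
    nth_rewrite 1 [← Rat.num_div_den q]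
    rw [one_div_div]
  have hnum' : (q.num : ℚ) ≠ 0 := by exact_mod_cast hnum.ne'
  constructor
  · obtain ⟨m, hm⟩ := (Dvd.intro_left _ rfl).trans (dvd_inputLimits hq)
    refine ⟨q.den * m, ?_⟩
    rw [hm, max_eq_right (by omega), hinv]
    push_cast
    rw [pow_one, hnat]
    field_simp
  · refine le_trans ?_ (two_pow_bits_le hq)
    rw [abs_of_pos (one_div_pos.2 h0), hinv]
    have h1 : (1 : ℚ) ≤ q.num := by exact_mod_cast hnum
    refine (div_le_self (by positivity) h1).trans ?_
    have h2 : q.den ≤ 2 ^ bits q :=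
      (Nat.lt_size_self _).le.trans (Nat.pow_le_pow_right (by norm_num) (Nat.le_add_left _ _))
    exact_mod_cast h2

theorem initMem_small (L : List (List ℚ)) (a i : ℕ) : (inputLimits L).Small 1 (initMem L a i) := by
  unfold initMem
  by_cases ha : a < L.length
  · rw [List.getD_eq_getElem _ _ ha]
    by_cases hi : i < L[a].length
    · rw [List.getD_eq_getElem _ _ hi]
      exact small_of_mem (List.mem_flatten.2 ⟨_, List.getElem_mem ha, List.getElem_mem hi⟩)
    · rw [List.getD_eq_default (n := i) (hn := by omega)]; exact Limits.small_zero _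
  · rw [List.getD_eq_default (n := a) (hn := by omega)]
    simpa using Limits.small_zero _

theorem good_initMem (L : List (List ℚ)) : (inputLimits L).Good (initMem L) := fun a i =>
  (initMem_small L a i).mono (by decide)

end

/-- Access to a matrix that is stored row by row. -/
theorem getD_ofFn_mul_add {n : ℕ} (f : Fin (n * n) → ℚ) (v w : Fin n) :
    ∃ k : Fin (n * n), k.divNat = v ∧ k.modNat = w ∧
      (List.ofFn f).getD ((v : ℕ) * n + w) 0 = f k := by
  have hlt : (v : ℕ) * n + w < n * n := by
    have h1 : ((v : ℕ) + 1) * n ≤ n * n := Nat.mul_le_mul_right _ v.2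
    have h2 := w.2
    rw [add_one_mul] at h1; omega
  have hn : 0 < n := v.pos
  refine ⟨⟨_, hlt⟩, ?_, ?_, ?_⟩
  · ext
    simp only [Fin.coe_divNat]
    rw [mul_comm, Nat.mul_add_div hn, Nat.div_eq_of_lt w.2, add_zero]
  · ext
    simp only [Fin.coe_modNat]
    rw [Nat.mul_add_mod', Nat.mod_eq_of_lt w.2]
  · rw [List.getD_eq_getElem _ _ (by simpa using hlt)]
    simp

theorem getD_flatMap_pair (L : List (ℚ × ℚ)) (i : ℕ) (hi : i < L.length) :
    (L.flatMap fun J => [J.1, J.2]).getD (2 * i) 0 = L[i].1 ∧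
      (L.flatMap fun J => [J.1, J.2]).getD (2 * i + 1) 0 = L[i].2 := by
  induction L generalizing i with
  | nil => simp at hi
  | cons J L ih =>
    cases i with
    | zero => simp
    | succ i =>
      have := ih i (by simpa using hi)
      simpa [mul_add, List.getD] using this

namespace Instance

variable (I : Instance)

/-- The size limits for computations with the instance `I`. -/
noncomputable def limits : Limits := inputLimits I.encode

open Classical in
/-- The cost matrix in the input, with entry `0` for non-edges. -/
noncomputable def costQ (v w : Fin I.n) : ℚ := if I.G.E v w then I.c v w else 0

/-- The input arrays hold the instance `I`. -/
def Loaded (σ : Mem) : Prop := ∀ a < 4, σ a = initMem I.encode a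

theorem n_pos : 0 < I.n := I.G.s.pos

variable {I} {σ : Mem}

theorem costQ_eq {v w : Fin I.n} (h : I.G.E v w) : (I.costQ v w : ℝ) = I.G.cost v w := by
  rw [costQ, if_pos h, I.cost_eq v w h]

theorem costQ_nonneg (v w : Fin I.n) : 0 ≤ I.costQ v w := by
  by_cases h : I.G.E v w
  · have := I.G.cost_nonneg v w h
    rw [← costQ_eq h] at this
    exact_mod_cast this
  · simp [costQ, h]

theorem Loaded.frame (h : I.Loaded σ) {σ' : Mem} {ws : List ℕ} (hf : ∀ a ∉ ws, σ' a = σ a)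
    (hws : ∀ a ∈ ws, 4 ≤ a) : I.Loaded σ' := fun a ha => by
  rw [hf a fun hmem => absurd (hws a hmem) (by omega), h a ha]

theorem loaded_initMem : I.Loaded (initMem I.encode) := fun _ _ => rfl

theorem initMem_eq_zero {a : ℕ} (ha : 4 ≤ a) (i : ℕ) : initMem I.encode a i = 0 := by
  unfold initMem
  rw [List.getD_eq_default (n := a) (hn := by simpa [encode] using ha)]
  simp

theorem Loaded.n (h : I.Loaded σ) : σ 0 0 = I.n := by
  rw [h 0 (by norm_num)]; simp [initMem, encode]

theorem Loaded.s (h : I.Loaded σ) : σ 0 1 = (I.G.s : ℕ) := by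
  rw [h 0 (by norm_num)]; simp [initMem, encode]

theorem Loaded.t (h : I.Loaded σ) : σ 0 2 = (I.G.t : ℕ) := by
  rw [h 0 (by norm_num)]; simp [initMem, encode]

theorem Loaded.numIntervals (h : I.Loaded σ) : σ 0 3 = I.intervals.length := by
  rw [h 0 (by norm_num)]; simp [initMem, encode]

open Classical in
theorem Loaded.adj (h : I.Loaded σ) (v w : Fin I.n) :
    σ 1 ((v : ℕ) * I.n + w) = if I.G.E v w then 1 else 0 := by
  rw [h 1 (by norm_num)]
  obtain ⟨k, rfl, rfl, hk⟩ := getD_ofFn_mul_add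
    (fun k : Fin (I.n * I.n) => if I.G.E k.divNat k.modNat then (1 : ℚ) else 0) v w
  exact hk

theorem Loaded.cost (h : I.Loaded σ) (v w : Fin I.n) :
    σ 2 ((v : ℕ) * I.n + w) = I.costQ v w := by
  classical
  rw [h 2 (by norm_num)]
  obtain ⟨k, rfl, rfl, hk⟩ := getD_ofFn_mul_add
    (fun k : Fin (I.n * I.n) => if I.G.E k.divNat k.modNat then I.c k.divNat k.modNat else 0) v w
  exact hk

theorem Loaded.interval (h : I.Loaded σ) (i : ℕ) (hi : i < I.intervals.length) :
    σ 3 (2 * i) = I.intervals[i].1 ∧ σ 3 (2 * i + 1) = I.intervals[i].2 := by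
  rw [h 3 (by norm_num)]
  exact getD_flatMap_pair I.intervals i hi

theorem Loaded.small (h : I.Loaded σ) {a : ℕ} (ha : a < 4) (i : ℕ) :
    I.limits.Small 1 (σ a i) := by
  rw [h a ha]; exact initMem_small _ _ _

theorem small_costQ (v w : Fin I.n) : I.limits.Small 1 (I.costQ v w) := by
  rw [← loaded_initMem.cost v w]; exact initMem_small _ _ _

theorem mul_self_le_limits : I.n * I.n ≤ I.limits.X := by
  classical
  have h := length_le_inputSize (L := I.encode) (l := List.ofFn fun k : Fin (I.n * I.n) =>
    if I.G.E k.divNat k.modNat then (1 : ℚ) else 0) (by simp [encode])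
  rw [List.length_ofFn] at h
  exact h

theorem n_le_limits : I.n ≤ I.limits.X := (Nat.le_mul_self _).trans mul_self_le_limits

theorem length_le_limits : I.intervals.length ≤ I.limits.X := by
  have h := length_le_inputSize (L := I.encode) (l := I.intervals.flatMap fun J => [J.1, J.2])
    (by simp [encode])
  have h2 : (I.intervals.flatMap fun J => [J.1, J.2]).length = I.intervals.length * 2 := by
    simp [List.length_flatMap]
  rw [h2] at h
  exact le_trans (by omega) h

theorem interval_mem_flatten {J : ℚ × ℚ} (hJ : J ∈ I.intervals) :
    J.1 ∈ I.encode.flatten ∧ J.2 ∈ I.encode.flatten := by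
  constructor <;>
  · refine List.mem_flatten.2 ⟨I.intervals.flatMap fun J => [J.1, J.2], by simp [encode], ?_⟩
    exact List.mem_flatMap.2 ⟨J, hJ, by simp⟩

theorem isBiasSet (I : Instance) : IsBiasSet I.B := by
  refine ⟨_, ⟨by simpa using I.valid.1, ?_⟩, rfl⟩
  intro J hJ
  obtain ⟨J, hJ', rfl⟩ := List.mem_map.1 hJ
  dsimp only
  exact_mod_cast I.valid.2 J hJ'

theorem sInf_B {J : ℚ × ℚ} (hJ : J ∈ I.intervals) (h : ∀ J' ∈ I.intervals, J.1 ≤ J'.1) :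
    sInf I.B = J.1 := by
  refine IsLeast.csInf_eq ⟨⟨_, List.mem_map.2 ⟨J, hJ, rfl⟩, le_rfl, ?_⟩, ?_⟩
  · dsimp only
    exact_mod_cast (I.valid.2 J hJ).2.1
  · rintro x ⟨K, hK, hx, -⟩
    obtain ⟨J', hJ', rfl⟩ := List.mem_map.1 hK
    exact le_trans (Rat.cast_le.2 (h J' hJ')) hx

theorem sSup_B {J : ℚ × ℚ} (hJ : J ∈ I.intervals) (h : ∀ J' ∈ I.intervals, J'.2 ≤ J.2) :
    sSup I.B = J.2 := by
  refine IsGreatest.csSup_eq ⟨⟨_, List.mem_map.2 ⟨J, hJ, rfl⟩, ?_, le_rfl⟩, ?_⟩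
  · dsimp only
    exact_mod_cast (I.valid.2 J hJ).2.1
  · rintro x ⟨K, hK, -, hx⟩
    obtain ⟨J', hJ', rfl⟩ := List.mem_map.1 hK
    exact hx.trans (Rat.cast_le.2 (h J' hJ'))

end Instance

/-! ### The ends of the present bias set and a bound for all costs

Besides the input in arrays 0 to 3 and the output in arrays 4 and 5, the program uses the following
arrays.  Arrays 6 and 7 hold distances and cheapest path successors, arrays 8 and 9 hold optimal
bottlenecks and the corresponding successors, array 10 marks the minmax path, and array 11 holds the
maximum costs on detours.  Arrays 12 to 15 and 20 to 24 serve as variables (`Term.cell`): the ends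
of the present bias set, a bound for all costs, loop counters, and current nodes of walks. -/

theorem floor_of_eq_natCast {x : ℚ} {m : ℕ} (h : x = m) : ⌊x⌋₊ = m := by
  rw [h, Nat.floor_natCast]

namespace Term

/-- Cell `0` of array `a`, which serves as a variable. -/
def cell (a : ℕ) : Term := .read a (.const 0)

/-- The number of nodes. -/
def numNodes : Term := .read 0 (.const 0)

/-- The position of the entry `(x, y)` of a matrix. -/
def entry (x y : Term) : Term := .add (.mul x numNodes) y

variable {l : Limits} {σ : Mem}

theorem _root_.PresentBias.Limits.Good.small_read (h : l.Good σ) {a : ℕ} {i : Term} :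
    l.Small cellLevel ((read a i).eval σ) := h _ _

theorem fine_const_zero : (const 0).Fine l σ := by simp [Fine]

theorem fine_const_one : (const 1).Fine l σ := by simp [Fine]

theorem fine_cell (a : ℕ) : (cell a).Fine l σ := by simp [Fine, cell]

theorem fine_numNodes : numNodes.Fine l σ := by simp [Fine, numNodes]

theorem fine_entry {x y : Term} (hx : x.Fine l σ) (hy : y.Fine l σ) : (entry x y).Fine l σ :=
  ⟨⟨hx, fine_numNodes⟩, hy⟩

theorem eval_cell (a : ℕ) : (cell a).eval σ = σ a 0 := by simp [eval, cell]

theorem eval_le_ne_zero {x y : Term} : (le x y).eval σ ≠ 0 ↔ x.eval σ ≤ y.eval σ := by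
  simp [eval]

theorem eval_le_eq_zero {x y : Term} : (le x y).eval σ = 0 ↔ y.eval σ < x.eval σ := by
  simp [eval]

theorem eval_mul (x y : Term) : (mul x y).eval σ = x.eval σ * y.eval σ := rfl

theorem eval_sub (x y : Term) : (sub x y).eval σ = x.eval σ - y.eval σ := rfl

theorem eval_numNodes {I : Instance} (h : I.Loaded σ) : numNodes.eval σ = I.n := by
  simp [eval, numNodes, h.n]

theorem floor_eval_entry {I : Instance} (h : I.Loaded σ) {x y : Term} {v w : ℕ}
    (hx : x.eval σ = v) (hy : y.eval σ = w) : ⌊(entry x y).eval σ⌋₊ = v * I.n + w := by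
  apply floor_of_eq_natCast
  simp only [entry, eval, hx, hy, eval_numNodes h]
  push_cast; rfl

end Term

namespace Prog

open Term

/-- Stores `min B` in array 12, `max B` in array 14 and `1 / min B` in array 15. -/
def biasEnds : Prog :=
  seq (write 12 (.const 0) (.read 3 (.const 0)))
  (seq (write 14 (.const 0) (.read 3 (.const 1)))
  (seq (loop 20 (.read 0 (.const 3))
    (seq
      (ite (.le (.read 3 (.mul (.const 2) (cell 20))) (cell 12))
        (write 12 (.const 0) (.read 3 (.mul (.const 2) (cell 20)))) skip)
      (ite (.le (cell 14) (.read 3 (.add (.mul (.const 2) (cell 20)) (.const 1))))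
        (write 14 (.const 0) (.read 3 (.add (.mul (.const 2) (cell 20)) (.const 1)))) skip)))
  (write 15 (.const 0) (.div (.const 1) (cell 12)))))

/-- What the end points `b` and `m` computed from the intervals satisfy. -/
structure BiasEnds (I : Instance) (b m : ℚ) : Prop where
  sInf_eq : sInf I.B = b
  sSup_eq : sSup I.B = m
  pos : 0 < b
  le_one : b ≤ 1
  small : I.limits.Small 1 b
  small_inv : I.limits.Small 1 (1 / b)
  small_max : I.limits.Small 1 m

theorem reaches_biasEnds {I : Instance} {σ : Mem} (hσ : I.limits.Good σ) (hI : I.Loaded σ) :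
    Reaches I.limits biasEnds σ fun σ' =>
      BiasEnds I (σ' 12 0) (σ' 14 0) ∧ σ' 15 0 = 1 / σ' 12 0 := by
  have hlen : 0 < I.intervals.length := List.length_pos_iff.2 I.valid.1
  let Inv : ℕ → Mem → Prop := fun i σ' => (∃ J ∈ I.intervals, σ' 12 0 = J.1) ∧
    (∃ J ∈ I.intervals, σ' 14 0 = J.2) ∧
    ∀ j (hj : j < I.intervals.length), j < i →
      σ' 12 0 ≤ I.intervals[j].1 ∧ I.intervals[j].2 ≤ σ' 14 0
  have hfirst := hI.interval 0 hlen
  apply reaches_seq (R := fun σ' => σ' 12 0 = I.intervals[0].1)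
  · apply reaches_write hσ fine_const_zero (by simp [Fine]) hσ.small_read
    simpa [eval, Mem.store_same] using hfirst.1
  intro σ₁ hσ₁ hfr₁ h₁
  have hI₁ := hI.frame hfr₁ (by simp [writes])
  apply reaches_seq (R := Inv 0)
  · apply reaches_write hσ₁ fine_const_zero (by simp [Fine]) hσ₁.small_read
    refine ⟨⟨_, List.getElem_mem hlen, ?_⟩, ⟨_, List.getElem_mem hlen, ?_⟩, by simp⟩
    · rw [Mem.store_ne _ (by norm_num), h₁]
    · simpa [eval, Mem.store_same] using (hI₁.interval 0 hlen).2
  intro σ₂ hσ₂ hfr₂ h₂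
  have hI₂ := hI₁.frame hfr₂ (by simp [writes])
  apply reaches_seq (R := Inv I.intervals.length)
  · apply reaches_loop Inv hσ₂ Instance.length_le_limits (by simp [writes])
      (fun _ => by simp [Fine]) _ _ h₂
    · intro i hi σ₃ hσ₃ hfr₃ hc hinv
      have hI₃ := hI₂.frame hfr₃ (by simp [writes])
      have hival := hI₃.interval i hi
      have hx1 : (Term.read 3 (.mul (.const 2) (cell 20))).eval σ₃ = I.intervals[i].1 := by
        simp only [eval, eval_cell, hc]
        rw [floor_of_eq_natCast (m := 2 * i) (by push_cast; rfl), hival.1]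
      apply reaches_seq (R := fun σ' => (∃ J ∈ I.intervals, σ' 12 0 = J.1) ∧
        (∃ J ∈ I.intervals, σ' 14 0 = J.2) ∧
        (∀ j (hj : j < I.intervals.length), j < i →
          σ' 12 0 ≤ I.intervals[j].1 ∧ I.intervals[j].2 ≤ σ' 14 0) ∧
          σ' 12 0 ≤ I.intervals[i].1 ∧ σ' 20 0 = i)
      · obtain ⟨hJ1, hJ2, hall⟩ := hinv
        apply reaches_ite hσ₃ (by simp [Fine, cell])
        · intro hle
          rw [eval_le_ne_zero, hx1, eval_cell] at hle
          apply reaches_write hσ₃ fine_const_zero (by simp [Fine, cell]) hσ₃.small_read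
          rw [hx1]
          simp only [eval, Nat.floor_zero, Mem.store_same, Function.update_self,
            Mem.store_ne _ (show 14 ≠ 12 by norm_num), Mem.store_ne _ (show 20 ≠ 12 by norm_num)]
          exact ⟨⟨_, List.getElem_mem hi, rfl⟩, hJ2,
            fun j hj hji => ⟨hle.trans (hall j hj hji).1, (hall j hj hji).2⟩, le_rfl, hc⟩
        · intro hle
          rw [eval_le_eq_zero, hx1, eval_cell] at hle
          exact reaches_skip hσ₃ ⟨hJ1, hJ2, hall, hle.le, hc⟩
      · rintro σ₄ hσ₄ hfr₄ ⟨hJ1, hJ2, hall, hi1, hc⟩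
        have hI₄ := hI₃.frame hfr₄ (by simp [writes])
        have hival := hI₄.interval i hi
        have hx2 : (Term.read 3 (.add (.mul (.const 2) (cell 20)) (.const 1))).eval σ₄ =
            I.intervals[i].2 := by
          simp only [eval, eval_cell, hc]
          rw [floor_of_eq_natCast (m := 2 * i + 1) (by push_cast; rfl), hival.2]
        apply reaches_ite hσ₄ (by simp [Fine, cell])
        · intro hle
          rw [eval_le_ne_zero, hx2, eval_cell] at hle
          apply reaches_write hσ₄ fine_const_zero (by simp [Fine, cell]) hσ₄.small_read
          rw [hx2]
          simp only [Inv, eval, Nat.floor_zero, Mem.store_same, Function.update_self,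
            Mem.store_ne _ (show 12 ≠ 14 by norm_num)]
          refine ⟨hJ1, ⟨_, List.getElem_mem hi, rfl⟩, fun j hj hji => ?_⟩
          rcases Nat.lt_succ_iff_lt_or_eq.1 hji with hji | rfl
          · exact ⟨(hall j hj hji).1, (hall j hj hji).2.trans hle⟩
          · exact ⟨hi1, le_rfl⟩
        · intro hle
          rw [eval_le_eq_zero, hx2, eval_cell] at hle
          refine reaches_skip hσ₄ ⟨hJ1, hJ2, fun j hj hji => ?_⟩
          rcases Nat.lt_succ_iff_lt_or_eq.1 hji with hji | rfl
          · exact hall j hj hji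
          · exact ⟨hi1, hle.le⟩
    · intro σ' hfr
      simp only [eval, Nat.floor_ofNat]
      exact (hI₂.frame hfr (by simp [writes])).numIntervals
    · intro i σ' q h
      simpa only [Inv, Mem.store_ne _ (show 12 ≠ 20 by norm_num),
        Mem.store_ne _ (show 14 ≠ 20 by norm_num)] using h
  rintro σ₃ hσ₃ hfr₃ ⟨⟨J, hJ, hb⟩, ⟨J', hJ', hm⟩, hall⟩
  have hends : BiasEnds I (σ₃ 12 0) (σ₃ 14 0) := by
    have hall' : ∀ K ∈ I.intervals, σ₃ 12 0 ≤ K.1 ∧ K.2 ≤ σ₃ 14 0 := by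
      intro K hK
      obtain ⟨j, hj, rfl⟩ := List.getElem_of_mem hK
      exact hall j hj hj
    rw [hb, hm] at hall' ⊢
    have hJv := I.valid.2 J hJ
    exact ⟨Instance.sInf_B hJ fun K hK => (hall' K hK).1,
      Instance.sSup_B hJ' fun K hK => (hall' K hK).2, hJv.1, hJv.2.1.trans hJv.2.2,
      small_of_mem (Instance.interval_mem_flatten hJ).1,
      small_inv_of_mem (Instance.interval_mem_flatten hJ).1 hJv.1,
      small_of_mem (Instance.interval_mem_flatten hJ').2⟩
  have hs : I.limits.Small cellLevel (1 / σ₃ 12 0) := hends.small_inv.mono (by decide)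
  apply reaches_write hσ₃ fine_const_zero
  · exact ⟨fine_const_one, fine_cell _, by simpa only [eval, eval_cell] using hs⟩
  · simpa only [eval, eval_cell] using hs
  · simp only [eval, eval_cell, Nat.floor_zero, Mem.store_same, Function.update_self,
      Mem.store_ne _ (show 12 ≠ 15 by norm_num), Mem.store_ne _ (show 14 ≠ 15 by norm_num)]
    exact ⟨hends, trivial⟩

/-- Stores an upper bound for all distances and perceived costs in array 13: the number of nodes
times the maximum cost of an edge. -/
def costBound : Prog :=
  seq (write 13 (.const 0) (.const 0))
  (seq (loop 20 (.mul numNodes numNodes)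
    (ite (.le (cell 13) (.read 2 (cell 20))) (write 13 (.const 0) (.read 2 (cell 20))) skip))
  (write 13 (.const 0) (.mul numNodes (cell 13))))

theorem reaches_costBound {I : Instance} {σ : Mem} (hσ : I.limits.Good σ) (hI : I.Loaded σ) :
    Reaches I.limits costBound σ fun σ' => ∃ C : ℚ, σ' 13 0 = I.n * C ∧ 0 ≤ C ∧
      I.limits.Small 1 C ∧ ∀ v w, I.costQ v w ≤ C := by
  let Inv : ℕ → Mem → Prop := fun i σ' => 0 ≤ σ' 13 0 ∧ I.limits.Small 1 (σ' 13 0) ∧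
    ∀ j < i, σ 2 j ≤ σ' 13 0
  apply reaches_seq (R := Inv 0)
  · apply reaches_write hσ fine_const_zero fine_const_zero (Limits.small_zero _)
    simp [Inv, eval, Mem.store_same, Limits.small_zero]
  intro σ₁ hσ₁ hfr₁ h₁
  have hI₁ := hI.frame hfr₁ (by simp [writes])
  apply reaches_seq (R := Inv (I.n * I.n))
  · apply reaches_loop Inv hσ₁ Instance.mul_self_le_limits (by simp [writes])
      (fun _ => by exact ⟨fine_numNodes, fine_numNodes⟩) _ _ h₁
    · rintro i hi σ₂ hσ₂ hfr₂ hc ⟨hpos, hs, hall⟩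
      have hI₂ := hI₁.frame hfr₂ (by simp [writes])
      have hx : (Term.read 2 (cell 20)).eval σ₂ = σ 2 i := by
        simp only [eval, eval_cell, hc, Nat.floor_natCast]
        rw [hI₂ 2 (by norm_num), hI 2 (by norm_num)]
      apply reaches_ite hσ₂ (by simp [Fine, cell])
      · intro hle
        rw [eval_le_ne_zero, hx, eval_cell] at hle
        apply reaches_write hσ₂ fine_const_zero (by simp [Fine, cell]) hσ₂.small_read
        rw [hx]
        simp only [Inv, eval, Nat.floor_zero, Mem.store_same, Function.update_self]
        refine ⟨hpos.trans hle, hI.small (by norm_num) _, fun j hj => ?_⟩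
        rcases Nat.lt_succ_iff_lt_or_eq.1 hj with hj | rfl
        · exact (hall j hj).trans hle
        · exact le_rfl
      · intro hle
        rw [eval_le_eq_zero, hx, eval_cell] at hle
        refine reaches_skip hσ₂ ⟨hpos, hs, fun j hj => ?_⟩
        rcases Nat.lt_succ_iff_lt_or_eq.1 hj with hj | rfl
        · exact hall j hj
        · exact hle.le
    · intro σ' hfr
      simp only [eval, eval_numNodes (hI₁.frame hfr (by simp [writes]))]
      push_cast; rfl
    · intro i σ' q h
      simpa only [Inv, Mem.store_ne _ (show 13 ≠ 20 by norm_num)] using h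
  rintro σ₂ hσ₂ hfr₂ ⟨hpos, hs, hall⟩
  have hI₂ := hI₁.frame hfr₂ (by simp [writes, loop])
  have hx : (Term.mul numNodes (cell 13)).eval σ₂ = I.n * σ₂ 13 0 := by
    simp only [eval, eval_cell, eval_numNodes hI₂]
  apply reaches_write hσ₂ fine_const_zero (by exact ⟨fine_numNodes, fine_cell _⟩)
  · rw [hx]
    exact ((Limits.small_natCast_of_le Instance.n_le_limits).mul hs).mono (by decide)
  · rw [hx]
    refine ⟨σ₂ 13 0, by simp [eval, Mem.store_same], hpos, hs, fun v w => ?_⟩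
    rw [← hI.cost v w]
    apply hall
    have h1 : ((v : ℕ) + 1) * I.n ≤ I.n * I.n := Nat.mul_le_mul_right _ v.2
    have h2 := w.2
    rw [add_one_mul] at h1; omega

end Prog

/-! ### The Bellman-Ford algorithm -/

namespace TaskGraph

variable {n : ℕ} {G : TaskGraph (Fin n)} {F : Fin n → Fin n → ℚ → ℚ} {val x p : Fin n → ℚ}
  {U : ℚ} {R : ℚ → Prop}

/-- State of the Bellman-Ford algorithm for the values `val`: the current estimates `x` are at
least as large as `val`, at most `U`, and have the property `R`.  The array `p` is meant to point to
the successors. -/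
structure Estimates (G : TaskGraph (Fin n)) (val : Fin n → ℚ) (U : ℚ) (R : ℚ → Prop)
    (x p : Fin n → ℚ) : Prop where
  le : ∀ v, val v ≤ x v
  le_bound : ∀ v, x v ≤ U
  prop : ∀ v, R (x v)
  x_t : x G.t = 0
  p_t : p G.t = (G.t : ℕ)

/-- The pointer at `v` justifies the estimate at `v`. -/
def Justified (G : TaskGraph (Fin n)) (F : Fin n → Fin n → ℚ → ℚ) (val x p : Fin n → ℚ)
    (v : Fin n) : Prop :=
  ∃ w : Fin n, G.E v w ∧ p v = (w : ℕ) ∧ F v w (val w) ≤ x v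

/-- The estimate and the pointer at `v` are final. -/
def Settled (G : TaskGraph (Fin n)) (F : Fin n → Fin n → ℚ → ℚ) (val x p : Fin n → ℚ)
    (v : Fin n) : Prop :=
  x v ≤ val v ∧ (v ≠ G.t → G.Justified F val x p v)

theorem Estimates.update (h : G.Estimates val U R x p) (hval : G.IsValue F val)
    (hF : ∀ v w, Monotone (F v w)) (hR : ∀ v w y, G.E v w → R y → R (F v w y)) {i j : Fin n}
    (hE : G.E i j) (hle : F i j (x j) ≤ x i) :
    G.Estimates val U R (Function.update x i (F i j (x j)))
      (Function.update p i ((j : ℕ) : ℚ)) := by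
  have hit := G.ne_t_of_edge hE
  refine ⟨fun v => ?_, fun v => ?_, fun v => ?_, ?_, ?_⟩
  · by_cases hv : v = i
    · subst hv; simpa using (hval.le v j hE).trans (hF v j (h.le j))
    · simpa [hv] using h.le v
  · by_cases hv : v = i
    · subst hv; simpa using hle.trans (h.le_bound v)
    · simpa [hv] using h.le_bound v
  · by_cases hv : v = i
    · subst hv; simpa using hR v j _ hE (h.prop j)
    · simpa [hv] using h.prop v
  · simpa [hit.symm] using h.x_t
  · simpa [hit.symm] using h.p_t

theorem Estimates.justified_update (h : G.Estimates val U R x p) (hF : ∀ v w, Monotone (F v w))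
    {i j : Fin n} (hE : G.E i j) :
    G.Justified F val (Function.update x i (F i j (x j))) (Function.update p i ((j : ℕ) : ℚ)) i :=
  ⟨j, hE, by simp, by simpa using hF i j (h.le j)⟩

theorem Estimates.settled_update (h : G.Estimates val U R x p) (hF : ∀ v w, Monotone (F v w))
    {i j : Fin n} (hE : G.E i j) (hle : F i j (x j) ≤ x i) {v : Fin n}
    (hv : G.Settled F val x p v) :
    G.Settled F val (Function.update x i (F i j (x j))) (Function.update p i ((j : ℕ) : ℚ)) v := by
  by_cases hvi : v = i
  · subst hvi
    exact ⟨by simpa using hle.trans hv.1, fun _ => h.justified_update hF hE⟩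
  · refine ⟨by simpa [hvi] using hv.1, fun hvt => ?_⟩
    obtain ⟨w, h1, h2, h3⟩ := hv.2 hvt
    exact ⟨w, h1, by simpa [hvi] using h2, by simpa [hvi] using h3⟩

theorem Estimates.settled_t (h : G.Estimates val U R x p) (hval : G.IsValue F val) :
    G.Settled F val x p G.t :=
  ⟨by rw [h.x_t, hval.val_t], fun hne => absurd rfl hne⟩

end TaskGraph

/-- The first `n` cells of an array. -/
def Mem.row (n : ℕ) (σ : Mem) (a : ℕ) : Fin n → ℚ := fun v => σ a v

theorem Mem.row_store_same {n : ℕ} (σ : Mem) (a : ℕ) (i : Fin n) (q : ℚ) :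
    (σ.store a i q).row n a = Function.update (σ.row n a) i q := by
  funext v
  simp only [Mem.row, Mem.store_same]
  by_cases hv : v = i
  · simp [hv]
  · rw [Function.update_of_ne hv, Function.update_of_ne (fun h => hv (Fin.ext h)), Mem.row]

theorem Mem.row_store_ne {n : ℕ} (σ : Mem) {a a' : ℕ} (h : a' ≠ a) (i : ℕ) (q : ℚ) :
    (σ.store a i q).row n a' = σ.row n a' := by
  funext v
  simp only [Mem.row, Mem.store_ne _ h]

namespace Prog

open Term

/-- Bellman-Ford algorithm.  Computes values in array `A` and pointers to the successors in
array `S`, starting from the upper bound in array 13.  The expression `f` evaluates an edge from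
the node in array 21 to the node in array 22. -/
def bellmanFord (A S : ℕ) (f : Term) : Prog :=
  seq (loop 20 numNodes (write A (cell 20) (cell 13)))
  (seq (write A (.read 0 (.const 2)) (.const 0))
  (seq (write S (.read 0 (.const 2)) (.read 0 (.const 2)))
  (loop 20 numNodes (loop 21 numNodes (loop 22 numNodes
    (ite (.mul (.read 1 (entry (cell 21) (cell 22))) (.le f (.read A (cell 21))))
      (seq (write A (cell 21) f) (write S (cell 21) (cell 22))) skip))))))

variable {I : Instance} {F : Fin I.n → Fin I.n → ℚ → ℚ} {val : Fin I.n → ℚ} {R : ℚ → Prop}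
  {A S : ℕ} {f : Term} {σ : Mem} {U : ℚ}

theorem reaches_bellmanFord_init (hσ : I.limits.Good σ) (hI : I.Loaded σ) (hA : 5 < A ∧ A < 12)
    (hAS : A ≠ S) {Q : Mem → Prop} {q : Prog} (hU : σ 13 0 = U)
    (hR0 : R 0) (hRU : R U) (hU0 : 0 ≤ U) (hval0 : val I.G.t = 0) (hvalU : ∀ v, val v ≤ U)
    (hq : ∀ σ', I.limits.Good σ' → (∀ a ∉ [A, S, 20], σ' a = σ a) →
      I.G.Estimates val U R (σ'.row I.n A) (σ'.row I.n S) → Reaches I.limits q σ' Q) :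
    Reaches I.limits
      (seq (loop 20 numNodes (write A (cell 20) (cell 13)))
      (seq (write A (.read 0 (.const 2)) (.const 0))
      (seq (write S (.read 0 (.const 2)) (.read 0 (.const 2))) q))) σ Q := by
  let Inv : ℕ → Mem → Prop := fun i σ' => ∀ v : Fin I.n, (v : ℕ) < i → σ'.row I.n A v = U
  apply reaches_seq (R := Inv I.n)
  · apply reaches_loop Inv hσ Instance.n_le_limits (by simp [writes]; omega)
      (fun _ => fine_numNodes) _ _ (by simp [Inv])
    · intro i hi σ₁ hσ₁ hfr hc hinv
      apply reaches_write hσ₁ (fine_cell _) (fine_cell _) hσ₁.small_read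
      rw [eval_cell, eval_cell, hc, Nat.floor_natCast, hfr 13 (by simp [writes]; omega), hU]
      intro v hv
      have := Mem.row_store_same σ₁ A ⟨i, hi⟩ U
      simp only at this
      rw [this]
      by_cases hvi : v = ⟨i, hi⟩
      · simp [hvi]
      · rw [Function.update_of_ne hvi]
        refine hinv v (lt_of_le_of_ne (Nat.lt_succ_iff.1 hv) fun h => hvi (Fin.ext h))
    · intro σ' hfr
      exact eval_numNodes (hI.frame hfr (by simp [writes]; omega))
    · intro i σ' q h
      simpa only [Inv, Mem.row_store_ne _ (show A ≠ 20 by omega)] using h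
  intro σ₁ hσ₁ hfr₁ h₁
  have hI₁ := hI.frame hfr₁ (by simp [writes, loop]; omega)
  have ht : ∀ σ', I.Loaded σ' → (Term.read 0 (.const 2)).eval σ' = ((I.G.t : ℕ) : ℚ) := by
    intro σ' h
    simp only [eval, Nat.floor_ofNat, h.t]
  apply reaches_seq (R := fun σ' => σ'.row I.n A = Function.update (fun _ => U) I.G.t 0)
  · apply reaches_write hσ₁ (by simp [Fine]) fine_const_zero (Limits.small_zero _)
    rw [ht _ hI₁, Nat.floor_natCast, Mem.row_store_same]
    simp only [eval]
    congr 1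
    funext v
    exact h₁ v v.2
  intro σ₂ hσ₂ hfr₂ h₂
  have hI₂ := hI₁.frame hfr₂ (by simp [writes]; omega)
  apply reaches_seq (R := fun σ' => I.G.Estimates val U R (σ'.row I.n A) (σ'.row I.n S))
  · apply reaches_write hσ₂ (by simp [Fine]) (by simp [Fine]) hσ₂.small_read
    rw [ht _ hI₂, Nat.floor_natCast, Mem.row_store_same, Mem.row_store_ne _ hAS, h₂]
    refine ⟨fun v => ?_, fun v => ?_, fun v => ?_, by simp, by simp⟩
    all_goals by_cases hv : v = I.G.t
    · simp [hv, hval0]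
    · simpa [hv] using hvalU v
    · simpa [hv] using hU0
    · simp [hv]
    · simpa [hv] using hR0
    · simpa [hv] using hRU
  intro σ₃ hσ₃ hfr₃ h₃
  refine hq σ₃ hσ₃ (fun a ha => ?_) h₃
  simp only [List.mem_cons, List.not_mem_nil, or_false, not_or] at ha
  rw [hfr₃ a (by simpa [writes] using ha.2.1), hfr₂ a (by simpa [writes] using ha.1),
    hfr₁ a (by simpa [writes, loop] using ⟨ha.2.2, ha.1, ha.2.2⟩)]

/-- Relaxation of the edge `(v, w)`. -/
theorem reaches_relax (hσ : I.limits.Good σ) (hI : I.Loaded σ) (hA : 5 < A ∧ A < 12)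
    (hAS : A ≠ S) {v w : Fin I.n} (hv : σ 21 0 = ((v : ℕ) : ℚ))
    (hw : σ 22 0 = ((w : ℕ) : ℚ)) (hest : I.G.Estimates val U R (σ.row I.n A) (σ.row I.n S))
    (hR : ∀ v w y, I.G.E v w → R y → R (F v w y))
    (hsmall : ∀ y, R y → y ≤ U → I.limits.Small cellLevel y)
    (hfine : ∀ σ, f.Fine I.limits σ) (hf : I.G.E v w → f.eval σ = F v w (σ A w))
    {Q : Mem → Prop}
    (hskip : (I.G.E v w → σ.row I.n A v < F v w (σ.row I.n A w)) → Q σ)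
    (hupd : I.G.E v w → F v w (σ.row I.n A w) ≤ σ.row I.n A v → ∀ σ',
      σ'.row I.n A = Function.update (σ.row I.n A) v (F v w (σ.row I.n A w)) →
      σ'.row I.n S = Function.update (σ.row I.n S) v ((w : ℕ) : ℚ) → Q σ') :
    Reaches I.limits (ite (.mul (.read 1 (entry (cell 21) (cell 22))) (.le f (.read A (cell 21))))
      (seq (write A (cell 21) f) (write S (cell 21) (cell 22))) skip) σ Q := by
  have hev : (cell 21).eval σ = ((v : ℕ) : ℚ) := by rw [eval_cell, hv]
  have hadj : (Term.read 1 (entry (cell 21) (cell 22))).eval σ = σ 1 ((v : ℕ) * I.n + w) := by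
    simp only [eval]
    rw [floor_eval_entry hI hev (by rw [eval_cell, hw])]
  have hcond : (Term.mul (.read 1 (entry (cell 21) (cell 22))) (.le f (.read A (cell 21)))).eval σ =
      σ 1 ((v : ℕ) * I.n + w) * if f.eval σ ≤ σ A v then 1 else 0 := by
    rw [← hadj]
    simp only [eval, eval_cell, hv, Nat.floor_natCast]
  apply reaches_ite hσ
    (by simp [Fine, cell, entry, numNodes, hfine])
  · intro hne
    rw [hcond, hI.adj] at hne
    have hE : I.G.E v w := by
      by_contra hE; simp [hE] at hne
    have hle : F v w (σ A w) ≤ σ A v := by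
      rw [← hf hE]
      by_contra hle; simp [hle] at hne
    apply reaches_seq (R := fun σ' =>
      σ'.row I.n A = Function.update (σ.row I.n A) v (F v w (σ.row I.n A w)) ∧
      σ'.row I.n S = σ.row I.n S)
    · apply reaches_write hσ (fine_cell _) (hfine _)
      · rw [hf hE]
        exact hsmall _ (hR _ _ _ hE (hest.prop w)) (hle.trans (hest.le_bound v))
      · rw [hev, hf hE, Nat.floor_natCast, Mem.row_store_same, Mem.row_store_ne _ hAS.symm]
        exact ⟨rfl, rfl⟩
    · rintro σ₁ hσ₁ hfr₁ ⟨h1, h2⟩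
      apply reaches_write hσ₁ (fine_cell _) (fine_cell _) hσ₁.small_read
      apply hupd hE hle
      · rw [Mem.row_store_ne _ hAS, h1]
      · rw [eval_cell, eval_cell, hfr₁ 21 (by simp [writes]; omega),
          hfr₁ 22 (by simp [writes]; omega), hv, hw, Nat.floor_natCast, Mem.row_store_same, h2]
  · intro h0
    refine reaches_skip hσ (hskip fun hE => lt_of_not_ge fun hle => ?_)
    rw [hcond, hI.adj, if_pos hE, hf hE] at h0
    have hle' : F v w (σ A w) ≤ σ A v := hle
    simp [hle'] at h0

/-- The Bellman-Ford algorithm computes the values `val` and optimal successors.  The property `R`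
of the estimates serves to bound the sizes of the numbers that occur. -/
theorem reaches_bellmanFord (hσ : I.limits.Good σ) (hI : I.Loaded σ) (hA : 5 < A ∧ A < 12)
    (hS : 5 < S ∧ S < 12) (hAS : A ≠ S) (hval : I.G.IsValue F val)
    (hF : ∀ v w, Monotone (F v w)) (hU : σ 13 0 = U) (hR0 : R 0) (hRU : R U)
    (hR : ∀ v w y, I.G.E v w → R y → R (F v w y)) (hU0 : 0 ≤ U) (hvalU : ∀ v, val v ≤ U)
    (hsmall : ∀ y, R y → y ≤ U → I.limits.Small cellLevel y)
    (hfine : ∀ σ, f.Fine I.limits σ)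
    (hf : ∀ σ', (∀ a ∉ [A, S, 20, 21, 22], σ' a = σ a) → ∀ v w : Fin I.n,
      σ' 21 0 = ((v : ℕ) : ℚ) → σ' 22 0 = ((w : ℕ) : ℚ) → I.G.E v w → f.eval σ' = F v w (σ' A w)) :
    Reaches I.limits (bellmanFord A S f) σ fun σ' => ∃ next : Fin I.n → Fin I.n,
      (∀ v : Fin I.n, σ' A v = val v ∧ R (σ' A v) ∧ σ' S v = (next v : ℕ)) ∧ next I.G.t = I.G.t ∧
      ∀ v, v ≠ I.G.t → I.G.E v (next v) ∧ F v (next v) (val (next v)) = val v := by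
  obtain ⟨h, hlt, hcard⟩ := I.G.exists_rank
  rw [Nat.card_fin] at hcard
  let Est : Mem → Prop := fun σ' => I.G.Estimates val U R (σ'.row I.n A) (σ'.row I.n S)
  let Don : Mem → Fin I.n → Prop := fun σ' v =>
    I.G.Settled F val (σ'.row I.n A) (σ'.row I.n S) v
  let Inv₁ : ℕ → Mem → Prop := fun k σ' => Est σ' ∧ ∀ v, h v < k → Don σ' v
  let Inv₂ : ℕ → ℕ → Mem → Prop := fun k i σ' => Inv₁ k σ' ∧
    ∀ v : Fin I.n, (v : ℕ) < i → h v ≤ k → Don σ' v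
  -- An edge that is not relaxed need not lead to a justified pointer at `i`, but then the estimate
  -- at `i` is strictly smaller than required, which is impossible for an optimal edge.
  let Inv₃ : ℕ → Fin I.n → ℕ → Mem → Prop := fun k i j σ' => Inv₂ k i σ' ∧
    (h i ≤ k → ∀ w : Fin I.n, (w : ℕ) < j → I.G.E i w → σ'.row I.n A i ≤ F i w (val w) ∧
      (σ'.row I.n A i < F i w (val w) ∨ I.G.Justified F val (σ'.row I.n A) (σ'.row I.n S) i))
  apply reaches_bellmanFord_init hσ hI hA hAS hU hR0 hRU hU0 hval.val_t hvalU
  intro σ₀ hσ₀ hfr₀ hest₀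
  have hI₀ := hI.frame hfr₀ (by simp; omega)
  have hnum : ∀ (ws : List ℕ), (∀ a ∈ ws, 4 ≤ a) → ∀ σ₁ : Mem, I.Loaded σ₁ →
      ∀ σ', (∀ a ∉ ws, σ' a = σ₁ a) → numNodes.eval σ' = I.n := fun ws hws σ₁ h₁ σ' hfr =>
    eval_numNodes (h₁.frame hfr hws)
  refine Reaches.mono (Q := Inv₁ I.n) ?_ ?_
  · apply reaches_loop Inv₁ hσ₀ Instance.n_le_limits (by simp [writes, loop]; omega)
      (fun _ => fine_numNodes) (hnum _ (by simp [writes, loop]; omega) _ hI₀) _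
      ⟨hest₀, by simp⟩
    · intro k hk σ₁ hσ₁ hfr₁ hc₁ hinv₁
      have hI₁ := hI₀.frame hfr₁ (by simp [writes, loop]; omega)
      refine Reaches.mono (Q := Inv₂ k I.n) ?_ fun σ' _ _ hinv =>
        ⟨hinv.1.1, fun v hv => hinv.2 v v.2 (Nat.lt_succ_iff.1 hv)⟩
      apply reaches_loop (Inv₂ k) hσ₁ Instance.n_le_limits (by simp [writes, loop]; omega)
        (fun _ => fine_numNodes) (hnum _ (by simp [writes, loop]; omega) _ hI₁) _
        ⟨hinv₁, by simp⟩
      · intro i hi σ₂ hσ₂ hfr₂ hc₂ hinv₂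
        have hI₂ := hI₁.frame hfr₂ (by simp [writes, loop]; omega)
        refine Reaches.mono (Q := Inv₃ k ⟨i, hi⟩ I.n) ?_ ?_
        · apply reaches_loop (Inv₃ k ⟨i, hi⟩) hσ₂ Instance.n_le_limits
            (by simp [writes]; omega)
            (fun _ => fine_numNodes) (hnum _ (by simp [writes]; omega) _ hI₂) _
            ⟨hinv₂, by simp⟩
          · rintro j hj σ₃ hσ₃ hfr₃ hc₃ ⟨⟨⟨hest, hdon⟩, hdon'⟩, hpart⟩
            have hI₃ := hI₂.frame hfr₃ (by simp [writes]; omega)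
            have hc₂' : σ₃ 21 0 = (((⟨i, hi⟩ : Fin I.n) : ℕ) : ℚ) := by
              rw [hfr₃ 21 (by simp [writes]; omega), hc₂]
            have hc₃' : σ₃ 22 0 = (((⟨j, hj⟩ : Fin I.n) : ℕ) : ℚ) := hc₃
            have hlast : ∀ w : Fin I.n, (w : ℕ) < j + 1 → (w : ℕ) < j ∨ w = ⟨j, hj⟩ :=
              fun w hw => (Nat.lt_succ_iff_lt_or_eq.1 hw).imp_right Fin.ext
            apply reaches_relax hσ₃ hI₃ hA hAS hc₂' hc₃' hest hR hsmall hfine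
            · intro hE
              refine hf σ₃ (fun a ha => ?_) _ _ hc₂' hc₃' hE
              simp only [List.mem_cons, List.not_mem_nil, or_false, not_or] at ha
              rw [hfr₃ a (by simp [writes]; tauto), hfr₂ a (by simp [writes, loop]; tauto),
                hfr₁ a (by simp [writes, loop]; tauto), hfr₀ a (by simp; tauto)]
            · intro hlt'
              refine ⟨⟨⟨hest, hdon⟩, hdon'⟩, fun hik w hw hE => ?_⟩
              rcases hlast w hw with hw | rfl
              · exact hpart hik w hw hE
              · have hlt'' := hlt' hE
                rw [le_antisymm (hdon _ ((hlt _ _ hE).trans_le hik)).1 (hest.le _)] at hlt''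
                exact ⟨hlt''.le, .inl hlt''⟩
            · intro hE hle σ₄ hxA hxS
              have hest' : Est σ₄ := by
                simp only [Est, hxA, hxS]; exact hest.update hval hF hR hE hle
              have hset : ∀ v, Don σ₃ v → Don σ₄ v := by
                intro v hv
                simp only [Don, hxA, hxS]; exact hest.settled_update hF hE hle hv
              have hjust := hest.justified_update (p := σ₃.row I.n S) hF hE
              rw [← hxA, ← hxS] at hjust
              refine ⟨⟨⟨hest', fun v hv => hset v (hdon v hv)⟩,
                fun v hv hvk => hset v (hdon' v hv hvk)⟩, fun hik w hw hE' => ⟨?_, .inr hjust⟩⟩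
              rw [hxA, Function.update_self]
              rcases hlast w hw with hw | rfl
              · exact hle.trans (hpart hik w hw hE').1
              · rw [le_antisymm (hdon _ ((hlt _ _ hE).trans_le hik)).1 (hest.le _)]
          · intro j σ' q h
            simpa only [Inv₃, Inv₂, Inv₁, Est, Don, Mem.row_store_ne _ (show A ≠ 22 by omega),
              Mem.row_store_ne _ (show S ≠ 22 by omega)] using h
        · rintro σ' - - ⟨⟨hinv, hdon⟩, hpart⟩
          refine ⟨hinv, fun v hv hvk => ?_⟩
          rcases Nat.lt_succ_iff_lt_or_eq.1 hv with hv | rfl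
          · exact hdon v hv hvk
          by_cases hvt : v = I.G.t
          · subst hvt; exact hinv.1.settled_t hval
          obtain ⟨w, hw, he⟩ := hval.exists_eq v hvt
          obtain ⟨h1, h2⟩ := hpart hvk w w.2 hw
          rw [he] at h1 h2
          exact ⟨h1, fun _ => h2.resolve_left (not_lt.2 (hinv.1.le v))⟩
      · intro j σ' q h
        simpa only [Inv₂, Inv₁, Est, Don, Mem.row_store_ne _ (show A ≠ 21 by omega),
          Mem.row_store_ne _ (show S ≠ 21 by omega)] using h
    · intro j σ' q h
      simpa only [Inv₁, Est, Don, Mem.row_store_ne _ (show A ≠ 20 by omega),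
        Mem.row_store_ne _ (show S ≠ 20 by omega)] using h
  · rintro σ' - - ⟨hest, hdon⟩
    have hx : ∀ v : Fin I.n, σ' A v = val v := fun v =>
      le_antisymm (hdon v (hcard v)).1 (hest.le v)
    have hnext : ∀ v : Fin I.n, ∃ w : Fin I.n, σ' S v = (w : ℕ) ∧ (v = I.G.t → w = I.G.t) ∧
        (v ≠ I.G.t → I.G.E v w ∧ F v w (val w) = val v) := by
      intro v
      by_cases hvt : v = I.G.t
      · exact ⟨I.G.t, by rw [hvt]; exact hest.p_t, fun _ => rfl, fun hne => absurd hvt hne⟩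
      · obtain ⟨w, hE, hp, hle⟩ := (hdon v (hcard v)).2 hvt
        exact ⟨w, hp, fun hne => absurd hne hvt, fun _ =>
          ⟨hE, le_antisymm (hle.trans (hx v).le) (hval.le v w hE)⟩⟩
    choose next h1 h2 h3 using hnext
    exact ⟨next, fun v => ⟨hx v, hest.prop v, h1 v⟩, h2 _ rfl, h3⟩

end Prog

/-! ### Distances, the minmax path and the detours from it -/

namespace Prog

open Term

variable {I : Instance} {σ : Mem}

theorem small_of_le_of_eq_int {y U : ℚ} {k : ℕ} (hk : k ≤ 2) (hU : I.limits.Small 2 U)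
    (hy : 0 ≤ y ∧ ∃ z : ℤ, y * (I.limits.N : ℚ) ^ k = z) (hyU : y ≤ U) : I.limits.Small 2 y := by
  obtain ⟨h0, z, hz⟩ := hy
  refine ⟨⟨z * (I.limits.N : ℤ) ^ (2 - k), ?_⟩, ?_⟩
  · push_cast
    rw [← hz, mul_assoc, ← pow_add, Nat.add_sub_cancel' hk]
  · rw [abs_of_nonneg h0]
    exact (hyU.trans (le_abs_self U)).trans hU.2

/-- Stores the distances to `t` in array 6 and the cheapest path successors in array 7. -/
def distances : Prog :=
  bellmanFord 6 7 (.add (.read 2 (entry (cell 21) (cell 22))) (.read 6 (cell 22)))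

theorem reaches_distances (hσ : I.limits.Good σ) (hI : I.Loaded σ) {C : ℚ}
    (hU : σ 13 0 = I.n * C) (hC : 0 ≤ C) (hCs : I.limits.Small 1 C)
    (hcost : ∀ v w, I.costQ v w ≤ C) :
    Reaches I.limits distances σ fun σ' => ∃ ς : Fin I.n → Fin I.n,
      (∀ v : Fin I.n, (σ' 6 v : ℝ) = I.G.dist I.G.cost v ∧
        (0 ≤ σ' 6 v ∧ ∃ z : ℤ, σ' 6 v * (I.limits.N : ℚ) ^ 1 = z) ∧ σ' 7 v = (ς v : ℕ)) ∧
      ς I.G.t = I.G.t ∧ I.G.IsCheapestSucc ς ∧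
      ∀ v w : Fin I.n, I.G.E v w → I.costQ v w + σ' 6 w ≤ I.n * C := by
  obtain ⟨val, hval⟩ := I.G.exists_isValue (fun v w x => I.costQ v w + x)
  have hreal : (fun v => (val v : ℝ)) = I.G.dist I.G.cost := by
    apply TaskGraph.IsValue.eq_dist
    refine ⟨by simp [hval.val_t], fun v w hE => ?_, fun v hv => ?_⟩
    · rw [← Instance.costQ_eq hE]
      exact_mod_cast hval.le v w hE
    · obtain ⟨w, hE, he⟩ := hval.exists_eq v hv
      refine ⟨w, hE, ?_⟩
      rw [← Instance.costQ_eq hE]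
      exact_mod_cast he
  obtain ⟨h, hlt, hcard⟩ := I.G.exists_rank
  rw [Nat.card_fin] at hcard
  have hrank : ∀ v, val v ≤ h v * C := by
    intro v
    induction v using I.G.reverse_induction with
    | ht => rw [hval.val_t]; positivity
    | hp v hv ih =>
      obtain ⟨w, hE⟩ := I.G.exists_edge hv
      have h1 := hval.le v w hE
      have h2 := ih w hE
      have h3 := hcost v w
      have h4 : ((h w + 1 : ℕ) : ℚ) * C ≤ h v * C :=
        mul_le_mul_of_nonneg_right (by exact_mod_cast hlt v w hE) hC
      push_cast at h4
      linarith
  have hle : ∀ v, (h v : ℚ) * C ≤ I.n * C := fun v =>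
    mul_le_mul_of_nonneg_right (by exact_mod_cast (hcard v).le) hC
  have hUs : I.limits.Small 2 (I.n * C) :=
    (Limits.small_natCast_of_le Instance.n_le_limits).mul hCs
  refine Reaches.mono (reaches_bellmanFord (F := fun v w x => I.costQ v w + x) (val := val)
    (R := fun y => 0 ≤ y ∧ ∃ z : ℤ, y * (I.limits.N : ℚ) ^ 1 = z) hσ hI (by norm_num) (by norm_num)
    (by norm_num) hval (fun v w x y hxy => by simpa using hxy) hU ⟨le_rfl, 0, by simp⟩ ⟨?_, ?_⟩
    ?_ ?_ (fun v => (hrank v).trans (hle v)) ?_ ?_ ?_) ?_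
  · positivity
  · obtain ⟨z, hz⟩ := hCs.1
    exact ⟨I.n * z, by push_cast; rw [← hz]; ring⟩
  · rintro v w y - ⟨h0, z, hz⟩
    obtain ⟨z', hz'⟩ := (Instance.small_costQ v w).1
    exact ⟨add_nonneg (Instance.costQ_nonneg v w) h0, z' + z, by
      push_cast; rw [← hz, ← hz']; ring⟩
  · positivity
  · exact fun y hy hyU => (small_of_le_of_eq_int (by norm_num) hUs hy hyU).mono (by decide)
  · intro σ
    simp [Fine, cell, entry, numNodes]
  · intro σ' hfr v w hv hw hE
    have hI' := hI.frame hfr (by simp)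
    simp only [eval, eval_cell]
    rw [floor_eval_entry hI' (by rw [eval_cell, hv]) (by rw [eval_cell, hw]), hI'.cost, hw,
      Nat.floor_natCast]
  · rintro σ' - - ⟨ς, h1, h2, h3⟩
    refine ⟨ς, fun v => ⟨?_, (h1 v).2⟩, h2, fun v hv => ⟨(h3 v hv).1, ?_⟩, fun v w hE => ?_⟩
    · rw [(h1 v).1, ← hreal]
    · rw [← hreal, ← Instance.costQ_eq (h3 v hv).1]
      dsimp only
      exact_mod_cast (h3 v hv).2
    · rw [(h1 w).1]
      have h4 := hrank w
      have h5 : ((h w + 1 : ℕ) : ℚ) * C ≤ h v * C :=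
        mul_le_mul_of_nonneg_right (by exact_mod_cast hlt v w hE) hC
      have h6 := hle v
      have h7 := hcost v w
      push_cast at h5
      linarith

/-- The maximum of two expressions. -/
def maxTerm (x y : Term) : Term :=
  .add (.mul (.le x y) y) (.mul (.sub (.const 1) (.le x y)) x)

theorem eval_maxTerm (x y : Term) : (maxTerm x y).eval σ = max (x.eval σ) (y.eval σ) := by
  simp only [maxTerm, eval]
  by_cases h : x.eval σ ≤ y.eval σ
  · simp [h]
  · simp [h, (not_le.1 h).le]

/-- Stores, for every node, the minimum over all paths to `t` of the maximum perceived cost of an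
edge in array 8, and the successors on optimal paths in array 9. -/
def bottlenecks : Prog :=
  bellmanFord 8 9 (maxTerm (.add (.read 2 (entry (cell 21) (cell 22)))
    (.mul (cell 12) (.read 6 (cell 22)))) (.read 8 (cell 22)))

theorem reaches_bottlenecks (hσ : I.limits.Good σ) (hI : I.Loaded σ) {C b m : ℚ}
    (hU : σ 13 0 = I.n * C) (hC : 0 ≤ C) (hCs : I.limits.Small 1 C) (hb : BiasEnds I b m)
    (hσb : σ 12 0 = b)
    (hd : ∀ v : Fin I.n, (σ 6 v : ℝ) = I.G.dist I.G.cost v ∧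
      (0 ≤ σ 6 v ∧ ∃ z : ℤ, σ 6 v * (I.limits.N : ℚ) ^ 1 = z))
    (hcost : ∀ v w : Fin I.n, I.G.E v w → I.costQ v w + σ 6 w ≤ I.n * C) :
    Reaches I.limits bottlenecks σ fun σ' => ∃ next : Fin I.n → Fin I.n,
      (∀ v : Fin I.n, σ' 9 v = (next v : ℕ) ∧ I.limits.Small 2 (σ' 8 v)) ∧
      next I.G.t = I.G.t ∧ (∀ v, v ≠ I.G.t → I.G.E v (next v)) ∧
      I.G.IsValue (fun v w x => max (I.G.perceived I.G.cost b v w) x)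
        (fun v => (σ' 8 v : ℝ)) ∧
      ∀ v, v ≠ I.G.t → max (I.G.perceived I.G.cost b v (next v)) (σ' 8 (next v)) = σ' 8 v := by
  let F : Fin I.n → Fin I.n → ℚ → ℚ := fun v w x => max (I.costQ v w + b * σ 6 w) x
  have hFreal : ∀ v w x, I.G.E v w →
      ((F v w x : ℚ) : ℝ) = max (I.G.perceived I.G.cost b v w) x := by
    intro v w x hE
    simp only [F, TaskGraph.perceived]
    push_cast
    rw [(hd w).1, Instance.costQ_eq hE]
  obtain ⟨val, hval⟩ := I.G.exists_isValue F
  have hreal : I.G.IsValue (fun v w x => max (I.G.perceived I.G.cost b v w) x)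
      (fun v => (val v : ℝ)) := by
    refine ⟨by simp [hval.val_t], fun v w hE => ?_, fun v hv => ?_⟩
    · rw [← hFreal v w _ hE]
      exact_mod_cast hval.le v w hE
    · obtain ⟨w, hE, he⟩ := hval.exists_eq v hv
      exact ⟨w, hE, by rw [← hFreal v w _ hE, he]⟩
  have hedge : ∀ v w, I.G.E v w → I.costQ v w + b * σ 6 w ≤ I.n * C := by
    intro v w hE
    have h1 := mul_le_of_le_one_left (hd w).2.1 hb.le_one
    linarith [hcost v w hE]
  have hvalU : ∀ v, val v ≤ I.n * C := by
    intro v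
    induction v using I.G.reverse_induction with
    | ht => rw [hval.val_t]; positivity
    | hp v hv ih =>
      obtain ⟨w, hE⟩ := I.G.exists_edge hv
      exact (hval.le v w hE).trans (max_le (hedge v w hE) (ih w hE))
  have hUs : I.limits.Small 2 (I.n * C) :=
    (Limits.small_natCast_of_le Instance.n_le_limits).mul hCs
  have hb0 := hb.pos
  refine Reaches.mono (reaches_bellmanFord (F := F) (val := val)
    (R := fun y => 0 ≤ y ∧ ∃ z : ℤ, y * (I.limits.N : ℚ) ^ 2 = z) hσ hI (by norm_num) (by norm_num)
    (by norm_num) hval (fun v w x y hxy => max_le_max le_rfl hxy) hU ⟨le_rfl, 0, by simp⟩ ⟨?_, ?_⟩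
    ?_ ?_ hvalU ?_ ?_ ?_) ?_
  · positivity
  · obtain ⟨z, hz⟩ := hCs.1
    exact ⟨I.n * z * I.limits.N, by push_cast; rw [← hz]; ring⟩
  · rintro v w y - hy
    by_cases hle : I.costQ v w + b * σ 6 w ≤ y
    · simpa only [F, max_eq_right hle] using hy
    · simp only [F, max_eq_left (not_le.1 hle).le]
      obtain ⟨z, hz⟩ := (Instance.small_costQ v w).1
      obtain ⟨z', hz'⟩ := hb.small.1
      obtain ⟨h0, z'', hz''⟩ := (hd w).2
      have h1 := Instance.costQ_nonneg v w
      exact ⟨by positivity, z * I.limits.N + z' * z'', by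
        push_cast; rw [← hz, ← hz', ← hz'']; ring⟩
  · positivity
  · exact fun y hy hyU => (small_of_le_of_eq_int le_rfl hUs hy hyU).mono (by decide)
  · intro σ
    simp [Fine, cell, entry, numNodes, maxTerm]
  · intro σ' hfr v w hv hw hE
    have hI' := hI.frame hfr (by simp)
    rw [eval_maxTerm]
    simp only [eval, eval_cell]
    rw [floor_eval_entry hI' (by rw [eval_cell, hv]) (by rw [eval_cell, hw]), hI'.cost, hw,
      Nat.floor_natCast, hfr 12 (by simp), hσb, hfr 6 (by simp)]
  · rintro σ' - - ⟨next, h1, h2, h3⟩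
    have h4 : (fun v : Fin I.n => (σ' 8 v : ℝ)) = fun v => (val v : ℝ) :=
      funext fun v => by rw [(h1 v).1]
    refine ⟨next, fun v => ⟨(h1 v).2.2, ?_⟩, h2, fun v hv => (h3 v hv).1, h4 ▸ hreal,
      fun v hv => ?_⟩
    · refine small_of_le_of_eq_int le_rfl hUs (h1 v).2.1 ?_
      rw [(h1 v).1]; exact hvalU v
    · rw [(h1 v).1, (h1 (next v)).1, ← hFreal v _ _ (h3 v hv).1]
      exact_mod_cast (h3 v hv).2

/-- Marks the nodes of the minmax path in array 10. -/
def markPath : Prog :=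
  seq (write 23 (.const 0) (.read 0 (.const 1)))
  (loop 20 numNodes
    (seq (write 10 (cell 23) (.const 1)) (write 23 (.const 0) (.read 9 (cell 23)))))

open Classical in
theorem reaches_markPath (hσ : I.limits.Good σ) (hI : I.Loaded σ) {next : Fin I.n → Fin I.n}
    (hnext : ∀ v : Fin I.n, σ 9 v = (next v : ℕ)) (h10 : ∀ i, σ 10 i = 0) :
    Reaches I.limits markPath σ fun σ' => ∀ v : Fin I.n,
      σ' 10 v = if ∃ k < I.n, next^[k] I.G.s = v then 1 else 0 := by
  let Inv : ℕ → Mem → Prop := fun i σ' => σ' 23 0 = ((next^[i] I.G.s : Fin I.n) : ℕ) ∧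
    ∀ v : Fin I.n, σ'.row I.n 10 v = if ∃ k < i, next^[k] I.G.s = v then 1 else 0
  apply reaches_seq (R := Inv 0)
  · apply reaches_write hσ fine_const_zero (by simp [Fine]) hσ.small_read
    refine ⟨by simp [eval, Mem.store_same, hI.s], fun v => ?_⟩
    rw [Mem.row_store_ne _ (by norm_num)]
    simp [Mem.row, h10]
  intro σ₁ hσ₁ hfr₁ h₁
  have hI₁ := hI.frame hfr₁ (by simp [writes])
  refine Reaches.mono (Q := Inv I.n) ?_ fun σ' _ _ h => h.2
  apply reaches_loop Inv hσ₁ Instance.n_le_limits (by simp [writes]) (fun _ => fine_numNodes)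
    (fun σ' hfr => eval_numNodes (hI₁.frame hfr (by simp [writes]))) _ h₁
  · rintro i hi σ₂ hσ₂ hfr₂ hc ⟨hcur, hmark⟩
    apply reaches_seq (R := fun σ' => σ' 23 0 = ((next^[i] I.G.s : Fin I.n) : ℕ) ∧
      ∀ v : Fin I.n, σ'.row I.n 10 v = if ∃ k < i + 1, next^[k] I.G.s = v then 1 else 0)
    · apply reaches_write hσ₂ (fine_cell _) fine_const_one (Limits.small_one _)
      rw [eval_cell, hcur, Nat.floor_natCast, Mem.store_ne _ (by norm_num), Mem.row_store_same]
      refine ⟨hcur, fun v => ?_⟩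
      by_cases hv : v = next^[i] I.G.s
      · rw [if_pos ⟨i, by omega, hv.symm⟩, hv, Function.update_self]; rfl
      · rw [Function.update_of_ne hv, hmark v]
        congr 1
        refine propext (exists_congr fun k => and_congr_left fun hk => ?_)
        have : k ≠ i := by rintro rfl; exact hv hk.symm
        omega
    · rintro σ₃ hσ₃ hfr₃ ⟨hcur₃, hmark₃⟩
      apply reaches_write hσ₃ fine_const_zero (by simp [Fine, cell]) hσ₃.small_read
      refine ⟨?_, fun v => ?_⟩
      · simp only [eval, eval_cell, hcur₃, Nat.floor_natCast, Nat.floor_zero, Mem.store_same,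
          Function.update_self]
        rw [hfr₃ 9 (by simp [writes]), hfr₂ 9 (by simp [writes]), hfr₁ 9 (by simp [writes]), hnext,
          Function.iterate_succ_apply']
      · rw [Mem.row_store_ne _ (by norm_num), hmark₃]
  · intro i σ' q h
    simpa only [Inv, Mem.store_ne _ (show 23 ≠ 20 by norm_num),
      Mem.row_store_ne _ (show 10 ≠ 20 by norm_num)] using h

end Prog

theorem maxOf_append_singleton (l : List ℝ) (x : ℝ) : maxOf (l ++ [x]) = max (maxOf l) x :=
  eq_of_forall_ge_iff fun c => by
    simp only [maxOf_le_iff, max_le_iff, List.mem_append, List.mem_singleton]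
    constructor
    · exact fun h => ⟨⟨h.1, fun y hy => h.2 y (.inl hy)⟩, h.2 x (.inr rfl)⟩
    · rintro ⟨⟨h0, h1⟩, h2⟩
      exact ⟨h0, fun y hy => hy.elim (h1 y) fun h => h ▸ h2⟩

/-- Pointers along edges lead from a node of rank `h v` to `t` within `h v` steps. -/
theorem TaskGraph.iterate_eq_t {V : Type*} {G : TaskGraph V} {next : V → V}
    (hnext : ∀ v, v ≠ G.t → G.E v (next v)) (ht : next G.t = G.t) {h : V → ℕ}
    (hlt : ∀ v w, G.E v w → h w < h v) {k : ℕ} {v : V} (hk : h v ≤ k) : next^[k] v = G.t := by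
  by_cases hv : v = G.t
  · rw [hv, Function.iterate_fixed ht]
  induction k generalizing v with
  | zero => have := hlt _ _ (hnext v hv); omega
  | succ k ih =>
    rw [Function.iterate_succ_apply]
    by_cases hv' : next v = G.t
    · rw [hv', Function.iterate_fixed ht]
    · exact ih (by have := hlt _ _ (hnext v hv); omega) hv'

namespace Prog

open Term

variable {I : Instance} {σ : Mem}

/-- Stores, for every node `v`, the maximum cost of an edge between `v` and the next marked node
on the cheapest path from `v` in array 11. -/
def detours : Prog :=
  loop 21 numNodes
    (seq (write 24 (.const 0) (.read 7 (cell 21)))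
    (seq (write 11 (cell 21) (.read 2 (entry (cell 21) (cell 24))))
    (loop 22 numNodes
      (ite (.read 10 (cell 24)) skip
        (seq
          (write 11 (cell 21)
            (maxTerm (.read 11 (cell 21)) (.read 2 (entry (cell 24) (.read 7 (cell 24))))))
          (write 24 (.const 0) (.read 7 (cell 24))))))))

/-- Maximum cost of the first `m` edges on the path `v, ς v, ς (ς v), …`. -/
noncomputable def maxCost (I : Instance) (ς : Fin I.n → Fin I.n) (v : Fin I.n) (m : ℕ) : ℝ :=
  maxOf ((List.range m).map fun i => (I.costQ (ς^[i] v) (ς^[i + 1] v) : ℝ))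

theorem maxCost_succ (ς : Fin I.n → Fin I.n) (v : Fin I.n) (m : ℕ) :
    maxCost I ς v (m + 1) = max (maxCost I ς v m) (I.costQ (ς^[m] v) (ς^[m + 1] v)) := by
  rw [maxCost, List.range_succ, List.map_append, List.map_singleton, maxOf_append_singleton]
  rfl

open Classical in
theorem reaches_detours (hσ : I.limits.Good σ) (hI : I.Loaded σ) {ς : Fin I.n → Fin I.n}
    (hς : ∀ v : Fin I.n, σ 7 v = (ς v : ℕ)) {p : Fin I.n → Prop}
    (hp : ∀ v : Fin I.n, σ 10 v = if p v then 1 else 0) (hreach : ∀ v, p (ς^[I.n] v)) :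
    Reaches I.limits detours σ fun σ' => ∀ v : Fin I.n, I.limits.Small 1 (σ' 11 v) ∧
      (σ' 11 v : ℝ) = maxCost I ς v (sInf {k : ℕ | 0 < k ∧ p (ς^[k] v)}) := by
  let Inv : ℕ → Mem → Prop := fun i σ' => ∀ v : Fin I.n, (v : ℕ) < i →
    I.limits.Small 1 (σ'.row I.n 11 v) ∧
      (σ'.row I.n 11 v : ℝ) = maxCost I ς v (sInf {k : ℕ | 0 < k ∧ p (ς^[k] v)})
  -- The walk from `v` has taken `m` steps; it stops as soon as it reaches a marked node, and
  -- otherwise `m = j + 1` after `j` iterations.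
  let Inv₂ : Fin I.n → ℕ → Mem → Prop := fun v j σ' => Inv v σ' ∧
    I.limits.Small 1 (σ'.row I.n 11 v) ∧ ∃ m, 0 < m ∧ m ≤ j + 1 ∧
      (m = j + 1 ∨ p (ς^[m] v)) ∧ (∀ k, 0 < k → k < m → ¬ p (ς^[k] v)) ∧
      σ' 24 0 = ((ς^[m] v : Fin I.n) : ℕ) ∧ (σ'.row I.n 11 v : ℝ) = maxCost I ς v m
  refine Reaches.mono (Q := Inv I.n) ?_ fun σ' _ _ h v => h v v.2
  apply reaches_loop Inv hσ Instance.n_le_limits (by simp [writes, loop])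
    (fun _ => fine_numNodes)
    (fun σ' hfr => eval_numNodes (hI.frame hfr (by simp [writes, loop]))) _ (by simp [Inv])
  · intro i hi σ₁ hσ₁ hfr₁ hc hinv
    have hI₁ := hI.frame hfr₁ (by simp [writes, loop])
    obtain ⟨v, rfl⟩ : ∃ v : Fin I.n, (v : ℕ) = i := ⟨⟨i, hi⟩, rfl⟩
    have hς₁ : ∀ v : Fin I.n, σ₁ 7 v = (ς v : ℕ) := by
      rw [hfr₁ 7 (by simp [writes, loop])]; exact hς
    apply reaches_seq (R := fun σ' => Inv v σ' ∧ σ' 24 0 = (ς v : ℕ))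
    · apply reaches_write hσ₁ fine_const_zero (by simp [Fine, cell]) hσ₁.small_read
      constructor
      · intro v' hv'
        rw [Mem.row_store_ne _ (by norm_num)]
        exact hinv v' hv'
      · simp [eval, eval_cell, Mem.store_same, hc, hς₁]
    rintro σ₂ hσ₂ hfr₂ ⟨hinv₂, hcur₂⟩
    have hI₂ := hI₁.frame hfr₂ (by simp [writes])
    have hc₂ : σ₂ 21 0 = (v : ℕ) := by rw [hfr₂ 21 (by simp [writes]), hc]
    have hval : (Term.read 2 (entry (cell 21) (cell 24))).eval σ₂ = I.costQ v (ς v) := by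
      simp only [eval]
      rw [floor_eval_entry hI₂ (by rw [eval_cell, hc₂]) (by rw [eval_cell, hcur₂]), hI₂.cost]
    apply reaches_seq (R := Inv₂ v 0)
    · apply reaches_write hσ₂ (fine_cell _) (by simp [Fine, cell, entry, numNodes]) hσ₂.small_read
      rw [hval, eval_cell, hc₂, Nat.floor_natCast]
      refine ⟨fun v' hv' => ?_, ?_, 1, by norm_num, by norm_num, .inl rfl, by omega, ?_, ?_⟩
      · rw [Mem.row_store_same, Function.update_of_ne (by rintro rfl; omega)]
        exact hinv₂ v' hv'
      · rw [Mem.row_store_same, Function.update_self]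
        exact Instance.small_costQ _ _
      · rw [Mem.store_ne _ (by norm_num), hcur₂]; rfl
      · rw [Mem.row_store_same, Function.update_self, maxCost]
        have h0 : (0 : ℝ) ≤ I.costQ v (ς v) := by exact_mod_cast Instance.costQ_nonneg v (ς v)
        simp [maxOf, h0]
    intro σ₃ hσ₃ hfr₃ hinv₃
    have hI₃ := hI₂.frame hfr₃ (by simp [writes])
    refine Reaches.mono (Q := Inv₂ v I.n) ?_ ?_
    · apply reaches_loop (Inv₂ v) hσ₃ Instance.n_le_limits (by simp [writes])
        (fun _ => fine_numNodes)
        (fun σ' hfr => eval_numNodes (hI₃.frame hfr (by simp [writes]))) _ hinv₃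
      · rintro j hj σ₄ hσ₄ hfr₄ - ⟨hinv₄, hsm, m, hm, hmj, hor, hnot, hcur, hmax⟩
        have hI₄ := hI₃.frame hfr₄ (by simp [writes])
        have hc₄ : σ₄ 21 0 = (v : ℕ) := by
          rw [hfr₄ 21 (by simp [writes]), hfr₃ 21 (by simp [writes]), hc₂]
        have hς₄ : ∀ v : Fin I.n, σ₄ 7 v = (ς v : ℕ) := by
          rw [hfr₄ 7 (by simp [writes]), hfr₃ 7 (by simp [writes]), hfr₂ 7 (by simp [writes])]
          exact hς₁
        have hmark : (Term.read 10 (cell 24)).eval σ₄ = if p (ς^[m] v) then 1 else 0 := by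
          simp only [eval, eval_cell, hcur, Nat.floor_natCast]
          rw [hfr₄ 10 (by simp [writes]), hfr₃ 10 (by simp [writes]), hfr₂ 10 (by simp [writes]),
            hfr₁ 10 (by simp [writes, loop]), hp]
        have hsuccEval : (Term.read 7 (cell 24)).eval σ₄ = ((ς^[m + 1] v : Fin I.n) : ℕ) := by
          simp only [eval, eval_cell, hcur, Nat.floor_natCast]
          rw [hς₄, Function.iterate_succ_apply']
        apply reaches_ite hσ₄ (by simp [Fine, cell])
        · intro hne
          rw [hmark] at hne
          have hpm : p (ς^[m] v) := by
            by_contra h; simp [h] at hne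
          exact reaches_skip hσ₄ ⟨hinv₄, hsm, m, hm, by omega, .inr hpm, hnot, hcur, hmax⟩
        · intro h0
          rw [hmark] at h0
          have hpm : ¬ p (ς^[m] v) := fun h => by simp [h] at h0
          obtain rfl := hor.resolve_right hpm
          have hcost : (Term.read 2 (entry (cell 24) (.read 7 (cell 24)))).eval σ₄ =
              I.costQ (ς^[j + 1] v) (ς^[j + 1 + 1] v) := by
            simp only [eval]
            rw [floor_eval_entry hI₄ (by rw [eval_cell, hcur]) hsuccEval, hI₄.cost]
          have hnew : (maxTerm (.read 11 (cell 21))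
              (.read 2 (entry (cell 24) (.read 7 (cell 24))))).eval σ₄ =
              max (σ₄.row I.n 11 v) (I.costQ (ς^[j + 1] v) (ς^[j + 1 + 1] v)) := by
            rw [eval_maxTerm, hcost]
            simp only [eval, eval_cell, hc₄, Nat.floor_natCast]
            rfl
          have hnewSmall : I.limits.Small 1
              (max (σ₄.row I.n 11 v) (I.costQ (ς^[j + 1] v) (ς^[j + 1 + 1] v))) := by
            rcases max_choice (σ₄.row I.n 11 v) (I.costQ (ς^[j + 1] v) (ς^[j + 1 + 1] v)) with h | h
            · rwa [h]
            · rw [h]; exact Instance.small_costQ _ _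
          apply reaches_seq (R := fun σ' => Inv v σ' ∧ I.limits.Small 1 (σ'.row I.n 11 v) ∧
            (σ'.row I.n 11 v : ℝ) = maxCost I ς v (j + 1 + 1))
          · apply reaches_write hσ₄ (fine_cell _)
              (by simp [Fine, cell, entry, numNodes, maxTerm])
            · rw [hnew]; exact hnewSmall.mono (by decide)
            · rw [hnew, eval_cell, hc₄, Nat.floor_natCast]
              refine ⟨fun v' hv' => ?_, ?_⟩
              · rw [Mem.row_store_same, Function.update_of_ne (by rintro rfl; omega)]
                exact hinv₄ v' hv'
              · rw [Mem.row_store_same, Function.update_self, maxCost_succ, ← hmax]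
                exact ⟨hnewSmall, by push_cast; rfl⟩
          · rintro σ₅ hσ₅ hfr₅ ⟨hinv₅, hsm₅, hmax₅⟩
            apply reaches_write hσ₅ fine_const_zero (by simp [Fine, cell]) hσ₅.small_read
            have hev : (Term.read 7 (cell 24)).eval σ₅ = ((ς^[j + 1 + 1] v : Fin I.n) : ℕ) := by
              rw [← hsuccEval]
              simp only [eval, eval_cell]
              rw [hfr₅ 24 (by simp [writes]), hfr₅ 7 (by simp [writes])]
            rw [hev]
            refine ⟨fun v' hv' => ?_, ?_, j + 1 + 1, by omega, le_rfl, .inl rfl, fun k hk hk' => ?_,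
              ?_, ?_⟩
            · rw [Mem.row_store_ne _ (by norm_num)]
              exact hinv₅ v' hv'
            · rw [Mem.row_store_ne _ (by norm_num)]
              exact hsm₅
            · rcases Nat.lt_succ_iff_lt_or_eq.1 hk' with hk' | rfl
              · exact hnot k hk hk'
              · exact hpm
            · simp [eval, Mem.store_same]
            · rw [Mem.row_store_ne _ (by norm_num)]
              exact hmax₅
      · intro j σ' q h
        simpa only [Inv₂, Inv, Mem.store_ne _ (show 24 ≠ 22 by norm_num),
          Mem.row_store_ne _ (show 11 ≠ 22 by norm_num)] using h
    · rintro σ' - - ⟨hinv', hsm, m, hm, hmj, hor, hnot, -, hmax⟩ v' hv'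
      rcases Nat.lt_succ_iff_lt_or_eq.1 hv' with hv' | hv'
      · exact hinv' v' hv'
      obtain rfl := Fin.ext hv'
      refine ⟨hsm, ?_⟩
      have hpm : p (ς^[m] v') := by
        refine hor.resolve_left fun h => ?_
        exact hnot I.n I.n_pos (by omega) (hreach v')
      have hinf : sInf {k : ℕ | 0 < k ∧ p (ς^[k] v')} = m :=
        IsLeast.csInf_eq ⟨⟨hm, hpm⟩, fun k hk => not_lt.1 fun hkm => hnot k hk.1 hkm hk.2⟩
      rw [hinf, hmax]
  · intro i σ' q h
    simpa only [Inv, Mem.row_store_ne _ (show 11 ≠ 21 by norm_num)] using h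

/-! ### The output -/

/-- The test `x = y`. -/
def eqTerm (x y : Term) : Term := .mul (.le x y) (.le y x)

theorem eval_eqTerm_natCast {x y : Term} {v w : ℕ} (hx : x.eval σ = v) (hy : y.eval σ = w) :
    (eqTerm x y).eval σ = if v = w then 1 else 0 := by
  simp only [eqTerm, eval, hx, hy, Nat.cast_le]
  by_cases h : v = w
  · simp [h]
  · rw [if_neg h]
    rcases Nat.lt_or_gt_of_ne h with h | h
    · simp [not_le.2 h]
    · simp [not_le.2 h]

/-- The range `τ` of the present bias set. -/
def tauTerm : Term := .mul (cell 14) (cell 15)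

/-- The reward `(1 + τ) * α / b`, where `α` is the optimal bottleneck at `s`. -/
def rewardTerm : Term :=
  .mul (.mul (.add (.const 1) tauTerm) (.read 8 (.read 0 (.const 1)))) (cell 15)

/-- Stores the extra costs in array 4. -/
def fees : Prog :=
  loop 21 numNodes (loop 22 numNodes
    (ite (.mul (.read 10 (cell 21)) (eqTerm (.read 9 (cell 21)) (cell 22)))
      (write 4 (entry (cell 21) (cell 22)) (.const 0))
      (ite (eqTerm (.read 7 (cell 21)) (cell 22))
        (write 4 (entry (cell 21) (cell 22))
          (.mul (.mul (.read 10 (cell 21)) (.sub (.const 1) (.read 10 (cell 22))))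
            (.mul tauTerm (.read 11 (cell 21)))))
        (write 4 (entry (cell 21) (cell 22)) (.add rewardTerm (.const 1))))))

open Classical in
/-- The extra costs for the marked nodes `p`, given the results of the previous computations. -/
noncomputable def feeQ {n : ℕ} (p : Fin n → Prop) (next ς : Fin n → Fin n) (D : Fin n → ℚ)
    (τ r : ℚ) (v w : Fin n) : ℚ :=
  if p v ∧ next v = w then 0
  else if ς v = w then if p v ∧ ¬ p w then τ * D v else 0
  else r + 1

theorem small_reward {m ib α : ℚ} (hm : I.limits.Small 1 m) (hib : I.limits.Small 1 ib)
    (hα : I.limits.Small 2 α) : I.limits.Small 7 ((1 + m * ib) * α * ib) :=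
  ((((Limits.small_one 1).add (hm.mul hib)).mul hα).mul hib)

theorem eval_rewardTerm (hI : I.Loaded σ) :
    rewardTerm.eval σ = (1 + σ 14 0 * σ 15 0) * σ 8 I.G.s * σ 15 0 := by
  simp only [rewardTerm, tauTerm, eval, eval_cell]
  rw [Nat.floor_one, hI.s, Nat.floor_natCast]

theorem fine_rewardTerm {l : Limits} : rewardTerm.Fine l σ := by
  simp [Fine, rewardTerm, tauTerm, cell]

theorem mul_add_injective {n : ℕ} {v v' w w' : Fin n}
    (h : (v : ℕ) * n + w = v' * n + w') : v = v' ∧ w = w' := by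
  have hn : 0 < n := v.pos
  have h1 := congrArg (· / n) h
  have h2 := congrArg (· % n) h
  simp only [mul_comm _ n, Nat.mul_add_div hn, Nat.div_eq_of_lt w.2, Nat.div_eq_of_lt w'.2,
    Nat.mul_add_mod, Nat.mod_eq_of_lt w.2, Nat.mod_eq_of_lt w'.2, add_zero] at h1 h2
  exact ⟨Fin.ext h1, Fin.ext h2⟩

open Classical in
theorem reaches_fees (hσ : I.limits.Good σ) (hI : I.Loaded σ) {ς next : Fin I.n → Fin I.n}
    (hς : ∀ v : Fin I.n, σ 7 v = (ς v : ℕ)) (hnext : ∀ v : Fin I.n, σ 9 v = (next v : ℕ))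
    {p : Fin I.n → Prop} (hp : ∀ v : Fin I.n, σ 10 v = if p v then 1 else 0)
    (hD : ∀ v : Fin I.n, I.limits.Small 1 (σ 11 v)) (hm : I.limits.Small 1 (σ 14 0))
    (hib : I.limits.Small 1 (σ 15 0)) (hα : I.limits.Small 2 (σ 8 I.G.s)) :
    Reaches I.limits fees σ fun σ' => ∀ v w : Fin I.n, σ' 4 ((v : ℕ) * I.n + w) =
      feeQ p next ς (fun v => σ 11 v) (σ 14 0 * σ 15 0)
        ((1 + σ 14 0 * σ 15 0) * σ 8 I.G.s * σ 15 0) v w := by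
  set fee := feeQ p next ς (fun v => σ 11 v) (σ 14 0 * σ 15 0)
        ((1 + σ 14 0 * σ 15 0) * σ 8 I.G.s * σ 15 0) with hfee
  let Inv : ℕ → ℕ → Mem → Prop := fun i j σ' => ∀ v w : Fin I.n,
    ((v : ℕ) < i ∨ (v : ℕ) = i ∧ (w : ℕ) < j) → σ' 4 ((v : ℕ) * I.n + w) = fee v w
  have hr := small_reward hm hib hα
  have hfeeSmall : ∀ v w, I.limits.Small cellLevel (fee v w) := by
    intro v w
    rw [hfee, feeQ]
    split_ifs
    · exact Limits.small_zero _
    · exact ((hm.mul hib).mul (hD v)).mono (by decide)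
    · exact Limits.small_zero _
    · exact (hr.add (Limits.small_one 1)).mono (by decide)
  refine Reaches.mono (Q := Inv I.n 0) ?_ fun σ' _ _ h v w => h v w (.inl v.2)
  apply reaches_loop (fun i => Inv i 0) hσ Instance.n_le_limits (by simp [writes, loop])
    (fun _ => fine_numNodes)
    (fun σ' hfr => eval_numNodes (hI.frame hfr (by simp [writes, loop]))) _ (by simp [Inv])
  · intro i hi σ₁ hσ₁ hfr₁ hc₁ hinv₁
    have hI₁ := hI.frame hfr₁ (by simp [writes, loop])
    refine Reaches.mono (Q := Inv i I.n) ?_ fun σ' _ _ h v w hvw =>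
      h v w (by have := w.2; omega)
    apply reaches_loop (Inv i) hσ₁ Instance.n_le_limits (by simp [writes])
      (fun _ => fine_numNodes)
      (fun σ' hfr => eval_numNodes (hI₁.frame hfr (by simp [writes]))) _ hinv₁
    · intro j hj σ₂ hσ₂ hfr₂ hc₂ hinv₂
      have hI₂ := hI₁.frame hfr₂ (by simp [writes])
      obtain ⟨v, rfl⟩ : ∃ v : Fin I.n, (v : ℕ) = i := ⟨⟨i, hi⟩, rfl⟩
      obtain ⟨w, rfl⟩ : ∃ w : Fin I.n, (w : ℕ) = j := ⟨⟨j, hj⟩, rfl⟩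
      have hfr : ∀ a ∉ [21, 22, 4], σ₂ a = σ a := by
        intro a ha
        simp only [List.mem_cons, List.not_mem_nil, or_false, not_or] at ha
        rw [hfr₂ a (by simp [writes]; tauto), hfr₁ a (by simp [writes, loop]; tauto)]
      have hv : (cell 21).eval σ₂ = (v : ℕ) := by
        rw [eval_cell, hfr₂ 21 (by simp [writes]), hc₁]
      have hw : (cell 22).eval σ₂ = (w : ℕ) := by rw [eval_cell, hc₂]
      have hread : ∀ a ∉ [21, 22, 4], (Term.read a (cell 21)).eval σ₂ = σ a v := by
        intro a ha
        simp only [eval, hv, Nat.floor_natCast, hfr a ha]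
      have hread' : ∀ a ∉ [21, 22, 4], (Term.read a (cell 22)).eval σ₂ = σ a w := by
        intro a ha
        simp only [eval, hw, Nat.floor_natCast, hfr a ha]
      -- each branch stores the intended extra cost
      have hstore : ∀ x : Term, x.Fine I.limits σ₂ → x.eval σ₂ = fee v w →
          Reaches I.limits (write 4 (entry (cell 21) (cell 22)) x) σ₂ (Inv v (w + 1)) := by
        intro x hx he
        apply reaches_write hσ₂ (fine_entry (fine_cell _) (fine_cell _)) hx
        · rw [he]; exact hfeeSmall v w
        · rw [he, floor_eval_entry hI₂ hv hw]
          intro v' w' hvw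
          rw [Mem.store_same]
          by_cases hEq : (v' : ℕ) * I.n + w' = v * I.n + w
          · rw [hEq, Function.update_self]
            obtain ⟨rfl, rfl⟩ := mul_add_injective hEq
            rfl
          · rw [Function.update_of_ne hEq]
            apply hinv₂
            rcases hvw with h | ⟨h, h'⟩
            · exact .inl h
            · refine .inr ⟨h, lt_of_le_of_ne (Nat.lt_succ_iff.1 h') fun h'' => hEq ?_⟩
              rw [h, h'']
      have hc1 : (Term.mul (.read 10 (cell 21)) (eqTerm (.read 9 (cell 21)) (cell 22))).eval σ₂ =
          if p v ∧ next v = w then 1 else 0 := by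
        rw [eval, eval_eqTerm_natCast ((hread 9 (by simp)).trans (hnext v)) hw,
          hread 10 (by simp), hp]
        simp only [Fin.val_inj]
        split_ifs <;> simp_all
      have hc2 : (eqTerm (.read 7 (cell 21)) (cell 22)).eval σ₂ = if ς v = w then 1 else 0 := by
        rw [eval_eqTerm_natCast ((hread 7 (by simp)).trans (hς v)) hw]
        simp only [Fin.val_inj]
      apply reaches_ite hσ₂ (by simp [Fine, cell, eqTerm])
      · intro hne
        rw [hc1] at hne
        have h1 : p v ∧ next v = w := by
          by_contra h; rw [if_neg h] at hne; exact hne rfl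
        exact hstore _ fine_const_zero (by rw [hfee, feeQ, if_pos h1]; rfl)
      · intro h0
        rw [hc1] at h0
        have h1 : ¬ (p v ∧ next v = w) := fun h => by
          rw [if_pos h] at h0; exact one_ne_zero h0
        apply reaches_ite hσ₂ (by simp [Fine, cell, eqTerm])
        · intro hne
          rw [hc2] at hne
          have h2 : ς v = w := by
            by_contra h; rw [if_neg h] at hne; exact hne rfl
          refine hstore _ (by simp [Fine, cell, tauTerm]) ?_
          rw [hfee, feeQ, if_neg h1, if_pos h2]
          simp only [eval_mul, eval_sub, hread 10 (by simp), hread' 10 (by simp),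
            hread 11 (by simp), tauTerm, eval_cell, hfr 14 (by simp), hfr 15 (by simp), hp]
          simp only [eval]
          split_ifs <;> simp_all
        · intro h0
          rw [hc2] at h0
          have h2 : ¬ ς v = w := fun h => by
            rw [if_pos h] at h0; exact one_ne_zero h0
          refine hstore _ (by simp [Fine, fine_rewardTerm]) ?_
          rw [hfee, feeQ, if_neg h1, if_neg h2, eval, eval_rewardTerm hI₂, hfr 14 (by simp),
            hfr 15 (by simp), hfr 8 (by simp)]
          rfl
    · intro j σ' q h
      simpa only [Inv, Mem.store_ne _ (show 4 ≠ 22 by norm_num)] using h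
  · intro j σ' q h
    simpa only [Inv, Mem.store_ne _ (show 4 ≠ 21 by norm_num)] using h

end Prog

namespace Prog

open Term

/-- The approximation algorithm. -/
def approx : Prog :=
  seq biasEnds (seq costBound (seq distances (seq bottlenecks (seq markPath (seq detours
    (seq fees (write 5 (.const 0) rewardTerm)))))))

open Classical in
/-- The algorithm terminates with the output for some valid choices of `P` and `ς`. -/
theorem reaches_approx (I : Instance) :
    Reaches I.limits approx (initMem I.encode) fun σ =>
      ∃ P ς, I.G.IsMinmaxPath (sInf I.B) P ∧ I.G.IsCheapestSucc ς ∧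
        (∀ v w, I.G.E v w →
          I.outFees σ v w = I.G.algFees (sInf I.B) (range I.B) P ς v w) ∧
        I.outReward σ = (1 + range I.B) * I.G.bottleneck (sInf I.B) P / sInf I.B := by
  obtain ⟨h, hlt, hcard⟩ := I.G.exists_rank
  rw [Nat.card_fin] at hcard
  have hσ₀ : I.limits.Good (initMem I.encode) := good_initMem _
  have hI₀ : I.Loaded (initMem I.encode) := Instance.loaded_initMem
  refine reaches_seq (reaches_biasEnds hσ₀ hI₀) ?_
  rintro σ₁ hσ₁ hfr₁ ⟨hends, hinv⟩
  have hI₁ := hI₀.frame hfr₁ (by decide)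
  refine reaches_seq (reaches_costBound hσ₁ hI₁) ?_
  rintro σ₂ hσ₂ hfr₂ ⟨C, hC, hC0, hCs, hcost⟩
  have hI₂ := hI₁.frame hfr₂ (by decide)
  refine reaches_seq (reaches_distances hσ₂ hI₂ hC hC0 hCs hcost) ?_
  rintro σ₃ hσ₃ hfr₃ ⟨ς, hd, hςt, hς, hcost'⟩
  have hI₃ := hI₂.frame hfr₃ (by decide)
  have hb₃ : σ₃ 12 0 = σ₁ 12 0 := by
    rw [hfr₃ 12 (by decide), hfr₂ 12 (by decide)]
  refine reaches_seq (reaches_bottlenecks hσ₃ hI₃ (by rw [hfr₃ 13 (by decide), hC]) hC0 hCs hends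
    hb₃ (fun v => ⟨(hd v).1, (hd v).2.1⟩) hcost') ?_
  rintro σ₄ hσ₄ hfr₄ ⟨next, hnext, hnextt, hE, hval, hopt⟩
  have hI₄ := hI₃.frame hfr₄ (by decide)
  have h10 : ∀ i, σ₄ 10 i = 0 := by
    intro i
    rw [hfr₄ 10 (by decide), hfr₃ 10 (by decide), hfr₂ 10 (by decide), hfr₁ 10 (by decide)]
    exact Instance.initMem_eq_zero (by norm_num) i
  refine reaches_seq (reaches_markPath hσ₄ hI₄ (fun v => (hnext v).1) h10) ?_
  intro σ₅ hσ₅ hfr₅ hmark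
  have hI₅ := hI₄.frame hfr₅ (by decide)
  obtain ⟨P, hP, hedge, hmem, hfold⟩ := I.G.exists_followPath hE I.G.s
  obtain ⟨p, hp⟩ : ∃ p : Fin I.n → Prop, ∀ v, p v ↔ v ∈ P := ⟨_, fun _ => Iff.rfl⟩
  have hmark' : ∀ v : Fin I.n, σ₅ 10 v = if p v then 1 else 0 := by
    intro v
    rw [hmark v]
    congr 1
    rw [hp, hmem hnextt v]
    refine propext ⟨fun ⟨k, _, hk⟩ => ⟨k, hk⟩, fun ⟨k, hk⟩ => ?_⟩
    by_cases hkn : k < I.n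
    · exact ⟨k, hkn, hk⟩
    · have hs := hcard I.G.s
      refine ⟨I.n - 1, by omega, ?_⟩
      rw [← hk, TaskGraph.iterate_eq_t hE hnextt hlt (by omega),
        TaskGraph.iterate_eq_t hE hnextt hlt (by omega)]
  have hς₅ : ∀ v : Fin I.n, σ₅ 7 v = (ς v : ℕ) := by
    rw [hfr₅ 7 (by decide), hfr₄ 7 (by decide)]
    exact fun v => (hd v).2.2
  refine reaches_seq (reaches_detours hσ₅ hI₅ hς₅ hmark' fun v => ?_) ?_
  · rw [TaskGraph.iterate_eq_t (fun v hv => (hς v hv).1) hςt hlt (hcard v).le]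
    exact (hp _).2 hP.t_mem
  intro σ₆ hσ₆ hfr₆ hD
  have hI₆ := hI₅.frame hfr₆ (by decide)
  have h8 : σ₆ 8 = σ₄ 8 := by rw [hfr₆ 8 (by decide), hfr₅ 8 (by decide)]
  have h14 : σ₆ 14 = σ₁ 14 := by
    rw [hfr₆ 14 (by decide), hfr₅ 14 (by decide), hfr₄ 14 (by decide), hfr₃ 14 (by decide),
      hfr₂ 14 (by decide)]
  have h15 : σ₆ 15 = σ₁ 15 := by
    rw [hfr₆ 15 (by decide), hfr₅ 15 (by decide), hfr₄ 15 (by decide), hfr₃ 15 (by decide),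
      hfr₂ 15 (by decide)]
  have hm₆ : I.limits.Small 1 (σ₆ 14 0) := by rw [h14]; exact hends.small_max
  have hib₆ : I.limits.Small 1 (σ₆ 15 0) := by rw [h15, hinv]; exact hends.small_inv
  have hα₆ : I.limits.Small 2 (σ₆ 8 I.G.s) := by rw [h8]; exact (hnext _).2
  refine reaches_seq (reaches_fees hσ₆ hI₆ (ς := ς) (next := next) (p := p) ?_ ?_ ?_
    (fun v => (hD v).1) hm₆ hib₆ hα₆) ?_
  · rw [hfr₆ 7 (by decide)]; exact hς₅
  · rw [hfr₆ 9 (by decide), hfr₅ 9 (by decide)]; exact fun v => (hnext v).1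
  · rw [hfr₆ 10 (by decide)]; exact hmark'
  intro σ₇ hσ₇ hfr₇ hfees
  have hI₇ := hI₆.frame hfr₇ (by decide)
  have hreward : rewardTerm.eval σ₇ =
      (1 + σ₁ 14 0 * (1 / σ₁ 12 0)) * σ₄ 8 I.G.s * (1 / σ₁ 12 0) := by
    rw [eval_rewardTerm hI₇, hfr₇ 14 (by decide), hfr₇ 15 (by decide), hfr₇ 8 (by decide), h14,
      h15, h8, hinv]
  have hbot : I.G.bottleneck (sInf I.B) P = σ₄ 8 I.G.s := by
    rw [TaskGraph.bottleneck_eq_foldPath, hends.sInf_eq]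
    exact hfold _ (fun v => (σ₄ 8 v : ℝ)) hval.val_t hopt
  have hτ : range I.B = σ₁ 14 0 * (1 / σ₁ 12 0) := by
    rw [range, hends.sInf_eq, hends.sSup_eq]; ring
  have hr : (1 + range I.B) * I.G.bottleneck (sInf I.B) P / sInf I.B =
      ((rewardTerm.eval σ₇ : ℚ) : ℝ) := by
    rw [hreward, hbot, hτ, hends.sInf_eq]
    push_cast
    ring
  have hminmax : I.G.IsMinmaxPath (sInf I.B) P := by
    have hval' := hval
    rw [← hends.sInf_eq] at hval'
    exact hval'.isMinmaxPath hP hbot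
  apply reaches_write hσ₇ fine_const_zero fine_rewardTerm
  · rw [hreward, ← hinv]
    exact (small_reward hends.small_max (hinv ▸ hends.small_inv) (hnext _).2).mono (by decide)
  · refine ⟨P, ς, hminmax, hς, fun v w hvw => ?_, ?_⟩
    · have hvt := I.G.ne_t_of_edge hvw
      rw [Instance.outFees, Mem.store_ne _ (by norm_num), hfees v w, TaskGraph.algFees, hr, hreward,
        feeQ]
      rw [h14, h15, h8, hinv]
      have hdet : I.G.detourMax P ς v = σ₆ 11 v := by
        rw [(hD v).2, maxCost, TaskGraph.detourMax]
        simp only [hp]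
        obtain ⟨-, -, hnot⟩ := hς.detour_spec hP.t_mem hvt
        congr 1
        refine List.map_congr_left fun i hi => ?_
        rw [List.mem_range] at hi
        have hne : ς^[i] v ≠ I.G.t := by
          rcases Nat.eq_zero_or_pos i with rfl | hi0
          · exact hvt
          · exact fun he => hnot i hi0 hi (he ▸ hP.t_mem)
        rw [Function.iterate_succ_apply', Instance.costQ_eq (hς _ hne).1]
      have hedge' : (v, w) ∈ pathEdges P ↔ v ∈ P ∧ next v = w :=
        (hedge v w).trans ⟨fun h => ⟨h.1, h.2.2.symm⟩, fun h => ⟨h.1, hvt, h.2.symm⟩⟩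
      simp only [hedge', hp, eq_comm (a := w), hdet, hτ]
      split_ifs <;> push_cast <;> rfl
    · rw [hr, Instance.outReward, Mem.store_same]
      simp [eval]

end Prog

end PresentBias

open PresentBias in
theorem theorem4 :
    -- the guarantee of the algorithm, for arbitrary real costs and present bias sets, and for
    -- every choice of the minmax path and of the cheapest path successors
    (∀ (V : Type*) [Finite V] (G : TaskGraph V) (B : Set ℝ), IsBiasSet B →
      (∃ P ς, G.IsMinmaxPath (sInf B) P ∧ G.IsCheapestSucc ς) ∧
      ∀ P ς, G.IsMinmaxPath (sInf B) P → G.IsCheapestSucc ς →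
        G.IsCostConfig (G.algFees (sInf B) (range B) P ς) ∧
        G.MotivatesAll B (G.algFees (sInf B) (range B) P ς)
          ((1 + range B) * G.bottleneck (sInf B) P / sInf B) ∧
        G.bottleneck (sInf B) P / sInf B ≤ G.optReward B ∧
        G.optReward B ≤ (1 + range B) * G.bottleneck (sInf B) P / sInf B) ∧
    -- the algorithm runs in polynomial time and is a `(1 + τ)`-approximation
    ∃ (prog : Prog) (p : Polynomial ℕ), ∀ I : Instance, ∃ (σ : Mem) (k : ℕ),
      Exec prog (initMem I.encode) σ k ∧ k ≤ p.eval (inputSize I.encode) ∧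
      (∃ P ς, I.G.IsMinmaxPath (sInf I.B) P ∧ I.G.IsCheapestSucc ς ∧
        (∀ v w, I.G.E v w →
          I.outFees σ v w = I.G.algFees (sInf I.B) (range I.B) P ς v w) ∧
        I.outReward σ = (1 + range I.B) * I.G.bottleneck (sInf I.B) P / sInf I.B) ∧
      I.G.IsCostConfig (I.outFees σ) ∧
      I.G.MotivatesAll I.B (I.outFees σ) (I.outReward σ) ∧
      I.G.optReward I.B ≤ I.outReward σ ∧
      I.outReward σ ≤ (1 + range I.B) * I.G.optReward I.B := by
  constructor
  · intro V _ G B hB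
    obtain ⟨P, hP⟩ := G.exists_isMinmaxPath (sInf B)
    obtain ⟨ς, hς⟩ := G.exists_isCheapestSucc
    exact ⟨⟨P, ς, hP, hς⟩, fun P ς hP hς => G.algFees_spec hB hP hς⟩
  · refine ⟨Prog.approx, Prog.approx.time * (3 * Polynomial.X + 3), fun I => ?_⟩
    obtain ⟨σ, k, hexec, hk, -, P, ς, hP, hς, hfees, hreward⟩ := Prog.reaches_approx I
    have hτ := I.isBiasSet.spec.2.2.1
    obtain ⟨hconf, hmot, hlow, hup⟩ := I.G.algFees_spec I.isBiasSet hP hς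
    refine ⟨σ, k, hexec, ?_, ⟨P, ς, hP, hς, hfees, hreward⟩, fun v w hE => ?_, fun β hβ => ?_, ?_,
      ?_⟩
    · simpa [Instance.limits, inputLimits] using hk
    · rw [hfees v w hE]; exact hconf v w hE
    · rw [hreward]
      exact TaskGraph.motivating_congr (fun v w hE => by rw [hfees v w hE]) (hmot β hβ)
    · rw [hreward]; exact hup
    · rw [hreward, mul_div_assoc]
      exact mul_le_mul_of_nonneg_left hlow (by linarith)
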